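/- Let $(M,\pi)$ be a smooth (finite-dimensional, Hausdorff, second countable) Poisson manifold, $(S,\omega)$ a symplectic manifold, and $I\subset\mathbb R$ a non-degenerate interval containing $0$ (for instance $[0,\epsilon_1)$). *Realization data* $(S,\omega,\alpha,\beta,\sigma)$ for a Poisson manifold $(M,\pi')$ consists of a Poisson map $\alpha:(S,\omega)\to(M,\pi')$ and an anti-Poisson map $\beta:(S,\omega)\to(M,\pi')$ with symplectically orthogonal fibres, $(\ker D_z\beta)^{\omega}=\ker D_z\alpha$ for all $z\in S$, and a smooth map $\sigma:M\to S$ with $\alpha\circ\sigma=\beta\circ\sigma=\mathrm{id}_M$ whose image is a Lagrangian submanifold. Two jointly smooth families $f_\epsilon,\hat f_\epsilon:S\to M$ $(\epsilon\in I)$ are *approximations of order $n$* of each other if $g\circ f_\epsilon-g\circ\hat f_\epsilon=O(\epsilon^{n+1})$ as $\epsilon\to0$ in $I$, uniformly on compact subsets of $S$, for every $g\in C^\infty(M)$ (for $M=\mathbb R^m$: $\|f_\epsilon-\hat f_\epsilon\|=O(\epsilon^{n+1})$ uniformly on compacts). *Approximate realization data of order $n$* for $(M,\epsilon\pi)$ is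 $\hat R_\epsilon=(S,\omega,\hat\alpha_\epsilon,\hat\beta_\epsilon,\sigma)$, $\epsilon\in I$, where $\hat\alpha_\epsilon,\hat\beta_\epsilon:S\to M$ are jointly smooth families with $\hat\alpha_\epsilon\circ\sigma=\hat\beta_\epsilon\circ\sigma=\mathrm{id}_M$ for all $\epsilon\in I$, which are approximations of order $n$ of jointly smooth families $\alpha_\epsilon,\beta_\epsilon$ such that $(S,\omega,\alpha_\epsilon,\beta_\epsilon,\sigma)$ is realization data for $(M,\epsilon\pi)$ for every $\epsilon\in I$. A submanifold $L\subset S$ is a *bisection* for $\alpha,\beta:S\to M$ if $\alpha|_L,\beta|_L:L\to M$ are diffeomorphisms. **Theorem.** Let $\hat R_\epsilon$, $\epsilon\in I$, be approximate realization data of order $n$ for $(M,\epsilon\pi)$, and let $J\subset I$ be a compact neighbourhood of $0$ in $I$. Then there is a neighbourhood $\mathcal U$ of $\sigma$ in the strong (Whitney) $C^1$ topology on maps $M\to S$ such that for every Lagrangian submanifold $L=\iota(M)$ of $(S,\omega)$ that is the image of a smooth embedding $\iota:M\to S$ with $\iota\in\mathcal U$: 1. $L$ is a bisection for $\hat\alpha_\epsilon$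 and $\hat\beta_\epsilon$, for every $\epsilon\in J$; 2. the induced map $\hat\varphi_{\epsilon,L}=\hat\alpha_\epsilon\circ(\hat\beta_\epsilon|_L)^{-1}:M\to M$ satisfies $\hat\varphi_{\epsilon,L}^*\pi-\pi=O(\epsilon^{n+1})$ as $\epsilon\to0$ in $I$, uniformly on compact subsets of $M$ (that is, $(\hat\varphi_{\epsilon,L}^*\pi)(df,dg)-\pi(df,dg)=O(\epsilon^{n+1})$ uniformly on compacts for all $f,g\in C^\infty(M)$); 3. for every Casimir $C\in C^\infty(M)$ of $\pi$, $\hat\varphi_{\epsilon,L}^*C-C=O(\epsilon^{n+1})$ as $\epsilon\to0$ in $I$, uniformly on compact subsets of $M$. -/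

import Mathlib

open scoped Manifold ContDiff Topology Bundle
open Set Bundle

noncomputable section PoissonGeometry

namespace PoissonRealization

section Bivectors

variable {E : Type*} [NormedAddCommGroup E] [NormedSpace ℝ E]
  {M : Type*} [TopologicalSpace M] [ChartedSpace E M]
  {F : Type*} [NormedAddCommGroup F] [NormedSpace ℝ F]
  {S : Type*} [TopologicalSpace S] [ChartedSpace F S]

/-- The differential `d_x f ∈ T*_x M` of a real function. -/
def differential (f : M → ℝ) (x : M) : TangentSpace 𝓘(ℝ, E) x →L[ℝ] ℝ :=
  mfderiv 𝓘(ℝ, E) 𝓘(ℝ, ℝ) f x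

/-- Smooth real functions on `M`. -/
def IsSmoothFun (E : Type*) [NormedAddCommGroup E] [NormedSpace ℝ E]
    {M : Type*} [TopologicalSpace M] [ChartedSpace E M] (f : M → ℝ) : Prop :=
  ContMDiff 𝓘(ℝ, E) 𝓘(ℝ, ℝ) ∞ f

/-- A (not necessarily continuous) field of bilinear forms on the cotangent spaces,
i.e. of contravariant 2-tensors. -/
abbrev TwoTensorField (E : Type*) [NormedAddCommGroup E] [NormedSpace ℝ E]
    (M : Type*) [TopologicalSpace M] [ChartedSpace E M] : Type _ :=
  ∀ x : M, (TangentSpace 𝓘(ℝ, E) x →L[ℝ] ℝ) →ₗ[ℝ] (TangentSpace 𝓘(ℝ, E) x →L[ℝ] ℝ) →ₗ[ℝ] ℝ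

/-- The bracket `{f, g} = P(df, dg)`. -/
def bracket (P : TwoTensorField E M) (f g : M → ℝ) (x : M) : ℝ :=
  P x (differential f x) (differential g x)

/-- `P` is a Poisson tensor: skew, smooth (smooth functions have smooth brackets), and its bracket
satisfies the Jacobi identity. -/
structure IsPoissonTensor (P : TwoTensorField E M) : Prop where
  skew : ∀ x ξ η, P x η ξ = -P x ξ η
  smooth : ∀ f g : M → ℝ, IsSmoothFun E f → IsSmoothFun E g → IsSmoothFun E (bracket P f g)
  jacobi : ∀ f g h : M → ℝ, IsSmoothFun E f → IsSmoothFun E g → IsSmoothFun E h → ∀ x,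
    bracket P (bracket P f g) h x + bracket P (bracket P h f) g x
      + bracket P (bracket P g h) f x = 0

/-- `C` is a Casimir function: smooth, with vanishing bracket with all smooth functions. -/
structure IsCasimir (P : TwoTensorField E M) (C : M → ℝ) : Prop where
  smooth : IsSmoothFun E C
  bracket_eq_zero : ∀ g : M → ℝ, IsSmoothFun E g → ∀ x, bracket P C g x = 0

/-- `φ : (S, P_S) → (M, P_M)` is a Poisson map: smooth, with
`{φ^*f, φ^*g}_S = φ^*{f, g}_M`. It is anti-Poisson if it is Poisson into `(M, -P_M)`. -/
structure IsPoissonMap (PS : TwoTensorField F S) (PM : TwoTensorField E M) (φ : S → M) : Prop where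
  smooth : ContMDiff 𝓘(ℝ, F) 𝓘(ℝ, E) ∞ φ
  map_bracket : ∀ f g : M → ℝ, IsSmoothFun E f → IsSmoothFun E g → ∀ z,
    bracket PS (f ∘ φ) (g ∘ φ) z = bracket PM f g (φ z)

/-- The pullback `φ^*P` by a diffeomorphism `φ`:
`(φ^*P)_x(ξ, η) = P_{φ(x)}(ξ ∘ (D_xφ)⁻¹, η ∘ (D_xφ)⁻¹)`. -/
def pullbackTensor (φ : M → M) (P : TwoTensorField E M) : TwoTensorField E M := fun x =>
  let A : TangentSpace 𝓘(ℝ, E) (φ x) →L[ℝ] TangentSpace 𝓘(ℝ, E) x :=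
    (mfderiv 𝓘(ℝ, E) 𝓘(ℝ, E) φ x).inverse
  LinearMap.mk₂ ℝ (fun ξ η => P (φ x) (ξ.comp A) (η.comp A))
    (fun ξ ξ' η => by simp [ContinuousLinearMap.add_comp])
    (fun c ξ η => by simp [ContinuousLinearMap.smul_comp])
    (fun ξ η η' => by simp [ContinuousLinearMap.add_comp])
    (fun c ξ η => by simp [ContinuousLinearMap.smul_comp])

end Bivectors

section Symplectic

/-- A symplectic form: a smooth, alternating, nondegenerate, closed 2-form. Closedness is expressed
by the invariant formula for `dΩ(X, Y, Z)` on smooth vector fields. -/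
structure SymplecticForm (F : Type*) [NormedAddCommGroup F] [NormedSpace ℝ F]
    (S : Type*) [TopologicalSpace S] [ChartedSpace F S] [IsManifold 𝓘(ℝ, F) ∞ S] where
  form : ∀ z : S, TangentSpace 𝓘(ℝ, F) z →L[ℝ] TangentSpace 𝓘(ℝ, F) z →L[ℝ] ℝ
  smooth : ContMDiff 𝓘(ℝ, F) (𝓘(ℝ, F).prod 𝓘(ℝ, F →L[ℝ] F →L[ℝ] ℝ)) ∞
    (fun z => TotalSpace.mk' (F →L[ℝ] F →L[ℝ] ℝ)
      (E := fun z : S => TangentSpace 𝓘(ℝ, F) z →L[ℝ] TangentSpace 𝓘(ℝ, F) z →L[ℝ] ℝ) z (form z))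
  alternating : ∀ z v, form z v v = 0
  nondegenerate : ∀ z v, (∀ w, form z v w = 0) → v = 0
  closed : ∀ X Y Z : ∀ z : S, TangentSpace 𝓘(ℝ, F) z,
    ContMDiff 𝓘(ℝ, F) 𝓘(ℝ, F).tangent ∞ (fun z => (⟨z, X z⟩ : TangentBundle 𝓘(ℝ, F) S)) →
    ContMDiff 𝓘(ℝ, F) 𝓘(ℝ, F).tangent ∞ (fun z => (⟨z, Y z⟩ : TangentBundle 𝓘(ℝ, F) S)) →
    ContMDiff 𝓘(ℝ, F) 𝓘(ℝ, F).tangent ∞ (fun z => (⟨z, Z z⟩ : TangentBundle 𝓘(ℝ, F) S)) →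
    ∀ z, differential (E := F) (fun y => form y (Y y) (Z y)) z (X z)
      + differential (E := F) (fun y => form y (Z y) (X y)) z (Y z)
      + differential (E := F) (fun y => form y (X y) (Y y)) z (Z z)
      - form z (VectorField.mlieBracket 𝓘(ℝ, F) X Y z) (Z z)
      - form z (VectorField.mlieBracket 𝓘(ℝ, F) Y Z z) (X z)
      - form z (VectorField.mlieBracket 𝓘(ℝ, F) Z X z) (Y z) = 0

variable {F : Type*} [NormedAddCommGroup F] [NormedSpace ℝ F] [FiniteDimensional ℝ F]
  {S : Type*} [TopologicalSpace S] [ChartedSpace F S] [IsManifold 𝓘(ℝ, F) ∞ S]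

namespace SymplecticForm

/-- A linear isomorphism `T_z S ≃ T*_z S`, `v ↦ Ω_z(v, ·)`. -/
def flat (Ω : SymplecticForm F S) (z : S) :
    TangentSpace 𝓘(ℝ, F) z ≃ₗ[ℝ] (TangentSpace 𝓘(ℝ, F) z →L[ℝ] ℝ) :=
  LinearEquiv.ofBijective (Ω.form z).toLinearMap (by
    have hinj : Function.Injective (Ω.form z).toLinearMap := by
      refine (injective_iff_map_eq_zero _).2 fun v hv => Ω.nondegenerate z v fun w => ?_
      exact congrArg (fun l : TangentSpace 𝓘(ℝ, F) z →L[ℝ] ℝ => l w) hv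
    have key : ∀ B : F →ₗ[ℝ] (F →L[ℝ] ℝ), Function.Injective B → Function.Surjective B := by
      intro B hB
      have hdim : Module.finrank ℝ F = Module.finrank ℝ (F →L[ℝ] ℝ) := by
        rw [← (LinearMap.toContinuousLinearMap (𝕜 := ℝ) (E := F) (F' := ℝ)).finrank_eq]
        exact (Subspace.dual_finrank_eq (K := ℝ) (V := F)).symm
      exact (LinearMap.injective_iff_surjective_of_finrank_eq_finrank hdim).1 hB
    exact ⟨hinj, key _ hinj⟩)

/-- The Poisson tensor of `Ω`: `P_Ω(ξ, η) = η(v)` with `Ω(v, ·) = ξ`. Thus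
`{f, g}_Ω = X_f(g)` with the Hamiltonian vector field `X_f` given by `Ω(X_f, ·) = df`;
for `Ω = dp ∧ dx` this gives `{x, p} = 1`. -/
def poissonTensor (Ω : SymplecticForm F S) : TwoTensorField F S := fun z =>
  LinearMap.mk₂ ℝ (fun ξ η => η ((Ω.flat z).symm ξ))
    (fun ξ ξ' η => by simp) (fun c ξ η => by simp) (fun ξ η η' => by simp) (fun c ξ η => by simp)

end SymplecticForm

variable {E : Type*} [NormedAddCommGroup E] [NormedSpace ℝ E]
  {M : Type*} [TopologicalSpace M] [ChartedSpace E M]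

/-- `ι : M → S` is a Lagrangian embedding, i.e. it parametrizes the embedded Lagrangian submanifold
`range ι` of `(S, Ω)`: isotropic and of half the dimension of `S`. -/
structure IsLagrangianEmbedding (Ω : SymplecticForm F S) (ι : M → S) : Prop where
  embedding : Manifold.IsSmoothEmbedding 𝓘(ℝ, E) 𝓘(ℝ, F) ∞ ι
  isotropic : ∀ (x : M) (v w : TangentSpace 𝓘(ℝ, E) x),
    Ω.form (ι x) (mfderiv 𝓘(ℝ, E) 𝓘(ℝ, F) ι x v) (mfderiv 𝓘(ℝ, E) 𝓘(ℝ, F) ι x w) = 0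
  half_dim : 2 * Module.finrank ℝ E = Module.finrank ℝ F

/-- `(S, Ω, α, β, σ)` is realization data for `(M, P)`. -/
structure IsRealizationData (Ω : SymplecticForm F S) (P : TwoTensorField E M)
    (α β : S → M) (σ : M → S) : Prop where
  poisson : IsPoissonMap Ω.poissonTensor P α
  antiPoisson : IsPoissonMap Ω.poissonTensor (-P) β
  /-- `ker D_zα` is the symplectic orthogonal of `ker D_zβ`. -/
  orthogonal : ∀ (z : S) (v : TangentSpace 𝓘(ℝ, F) z),
    mfderiv 𝓘(ℝ, F) 𝓘(ℝ, E) α z v = 0 ↔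
      ∀ w : TangentSpace 𝓘(ℝ, F) z, mfderiv 𝓘(ℝ, F) 𝓘(ℝ, E) β z w = 0 → Ω.form z w v = 0
  section_left : ∀ x, α (σ x) = x
  section_right : ∀ x, β (σ x) = x
  lagrangian : IsLagrangianEmbedding (E := E) Ω σ

end Symplectic

section Approximation

/-- `r_ε = O(ε^k)` as `ε → 0` in `I`, uniformly on compact sets. -/
def IsUniformO {X : Type*} [TopologicalSpace X] (I : Set ℝ) (k : ℕ) (r : ℝ → X → ℝ) : Prop :=
  ∀ K : Set X, IsCompact K → ∃ C : ℝ, ∃ δ > 0, ∀ ε ∈ I, |ε| < δ → ∀ x ∈ K,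
    |r ε x| ≤ C * |ε| ^ k

variable {E : Type*} [NormedAddCommGroup E] [NormedSpace ℝ E]
  {M : Type*} [TopologicalSpace M] [ChartedSpace E M]
  {F : Type*} [NormedAddCommGroup F] [NormedSpace ℝ F]
  {S : Type*} [TopologicalSpace S] [ChartedSpace F S]

/-- A family of maps `f_ε : S → M`, `ε ∈ I`, that is jointly smooth on `S × I`. -/
def IsSmoothFamily (F : Type*) [NormedAddCommGroup F] [NormedSpace ℝ F]
    (E : Type*) [NormedAddCommGroup E] [NormedSpace ℝ E]
    {S : Type*} [TopologicalSpace S] [ChartedSpace F S]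
    {M : Type*} [TopologicalSpace M] [ChartedSpace E M]
    (I : Set ℝ) (f : ℝ → S → M) : Prop :=
  ContMDiffOn (𝓘(ℝ, F).prod 𝓘(ℝ, ℝ)) 𝓘(ℝ, E) ∞ (fun p : S × ℝ => f p.2 p.1) (univ ×ˢ I)

/-- `f_ε = f̂_ε mod O(ε^{n+1})` for two families of maps into a manifold: after composition with any
smooth function on `M`, the difference is `O(ε^{n+1})` uniformly on compacts. For jointly smooth
families into a vector space this says the same as `‖f_ε(z) - f̂_ε(z)‖ = O(ε^{n+1})`
uniformly on compacts. -/
def IsApproximation (E : Type*) [NormedAddCommGroup E] [NormedSpace ℝ E]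
    {M : Type*} [TopologicalSpace M] [ChartedSpace E M] {S : Type*} [TopologicalSpace S]
    (I : Set ℝ) (n : ℕ) (f fhat : ℝ → S → M) : Prop :=
  ∀ g : M → ℝ, IsSmoothFun E g →
    IsUniformO I (n + 1) (fun ε z => g (f ε z) - g (fhat ε z))

/-- `(S, Ω, α̂_ε, β̂_ε, σ)`, `ε ∈ I`, is approximate realization data of order `n` for
`(M, εP)`: the maps `α̂`, `β̂` approximate to order `n` those of a smooth family of realization
data `(S, Ω, α_ε, β_ε, σ)` for `(M, εP)`, and `σ` is a section of both. -/
structure IsApproxRealizationData [FiniteDimensional ℝ F] [IsManifold 𝓘(ℝ, F) ∞ S]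
    (Ω : SymplecticForm F S) (P : TwoTensorField E M) (I : Set ℝ) (n : ℕ)
    (αhat βhat : ℝ → S → M) (σ : M → S) : Prop where
  smooth_left : IsSmoothFamily F E I αhat
  smooth_right : IsSmoothFamily F E I βhat
  section_left : ∀ ε ∈ I, ∀ x, αhat ε (σ x) = x
  section_right : ∀ ε ∈ I, ∀ x, βhat ε (σ x) = x
  approximates : ∃ α β : ℝ → S → M,
    IsSmoothFamily F E I α ∧ IsSmoothFamily F E I β ∧
    (∀ ε ∈ I, IsRealizationData Ω (ε • P) (α ε) (β ε) σ) ∧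
    IsApproximation E I n α αhat ∧ IsApproximation E I n β βhat

end Approximation

section PullbackInstances

variable {B B' : Type*} (f : B' → B) (V : B → Type*)

instance instAddCommGroupPullback [∀ x, AddCommGroup (V x)] (x : B') :
    AddCommGroup ((f *ᵖ V) x) :=
  inferInstanceAs (AddCommGroup (V (f x)))

instance instIsTopologicalAddGroupPullback [∀ x, AddCommGroup (V x)]
    [∀ x, TopologicalSpace (V x)] [∀ x, IsTopologicalAddGroup (V x)] (x : B') :
    IsTopologicalAddGroup ((f *ᵖ V) x) :=
  inferInstanceAs (IsTopologicalAddGroup (V (f x)))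

instance instContinuousSMulPullback [∀ x, AddCommGroup (V x)] [∀ x, Module ℝ (V x)]
    [∀ x, TopologicalSpace (V x)] [∀ x, ContinuousSMul ℝ (V x)] (x : B') :
    ContinuousSMul ℝ ((f *ᵖ V) x) :=
  inferInstanceAs (ContinuousSMul ℝ (V (f x)))

end PullbackInstances

section Bisections

variable {E : Type*} [NormedAddCommGroup E] [NormedSpace ℝ E]
  {M : Type*} [TopologicalSpace M] [ChartedSpace E M]
  {F : Type*} [NormedAddCommGroup F] [NormedSpace ℝ F]
  {S : Type*} [TopologicalSpace S] [ChartedSpace F S]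

/-- The smooth map `α : S → M` restricts to a diffeomorphism `L → M`, for a submanifold `L ⊆ S`:
it restricts to a bijection, and the inverse `s : M → L ⊆ S` is smooth. -/
def RestrictsToDiffeo (F : Type*) [NormedAddCommGroup F] [NormedSpace ℝ F]
    (E : Type*) [NormedAddCommGroup E] [NormedSpace ℝ E]
    {S : Type*} [TopologicalSpace S] [ChartedSpace F S]
    {M : Type*} [TopologicalSpace M] [ChartedSpace E M] (α : S → M) (L : Set S) : Prop :=
  BijOn α L univ ∧ ∃ s : M → S, ContMDiff 𝓘(ℝ, E) 𝓘(ℝ, F) ∞ s ∧ (∀ x, s x ∈ L) ∧ ∀ x, α (s x) = x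

/-- The submanifold `L ⊆ S` is a bisection for `α` and `β`. -/
def IsBisection (F : Type*) [NormedAddCommGroup F] [NormedSpace ℝ F]
    (E : Type*) [NormedAddCommGroup E] [NormedSpace ℝ E]
    {S : Type*} [TopologicalSpace S] [ChartedSpace F S]
    {M : Type*} [TopologicalSpace M] [ChartedSpace E M] (α β : S → M) (L : Set S) : Prop :=
  RestrictsToDiffeo F E α L ∧ RestrictsToDiffeo F E β L

open Classical in
/-- The induced map `φ_L = α ∘ (β|_L)⁻¹` (the value `x` is used only outside `β(L)`,
which is all of `M` for a bisection). -/
def inducedMap {S M : Type*} (α β : S → M) (L : Set S) (x : M) : M :=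
  if h : ∃ z ∈ L, β z = x then α h.choose else x

/-- The space `J¹(M, S)` of 1-jets of maps `M → S`: the bundle over `M × S` with fibre
`Hom(T_x M, T_y S)`, with the vector bundle topology. -/
abbrev OneJets (E : Type*) [NormedAddCommGroup E] [NormedSpace ℝ E]
    (M : Type*) [TopologicalSpace M] [ChartedSpace E M]
    (F : Type*) [NormedAddCommGroup F] [NormedSpace ℝ F]
    (S : Type*) [TopologicalSpace S] [ChartedSpace F S] : Type _ :=
  TotalSpace (E →L[ℝ] F) (fun p : M × S =>
    ((ContinuousMap.fst : C(M × S, M)) *ᵖ (TangentSpace 𝓘(ℝ, E) : M → Type _)) p →L[ℝ]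
      ((ContinuousMap.snd : C(M × S, S)) *ᵖ (TangentSpace 𝓘(ℝ, F) : S → Type _)) p)

/-- The 1-jet `(x, f(x), D_x f)` of `f` at `x`. -/
def oneJet (f : M → S) (x : M) : OneJets E M F S :=
  ⟨(x, f x), mfderiv 𝓘(ℝ, E) 𝓘(ℝ, F) f x⟩

/-- The basic open set of the strong (Whitney) `C¹` topology on maps `M → S` that is given by
a set `W` of 1-jets: all 1-jets of `f` lie in `W`. -/
def JetsIn (W : Set (OneJets E M F S)) (f : M → S) : Prop :=
  ∀ x, oneJet f x ∈ W

end Bisections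

end PoissonRealization

end PoissonGeometry

/-!
A map `ι` whose 1-jets are close to those of the section `σ` makes `α_ε ∘ ι` and `β_ε ∘ ι` close to
the identity together with their differentials, on a compact range of `ε`, and such maps are
diffeomorphisms, proper uniformly in `ε`. The approximate realization data have the same section,
so the argument applies to them as well and gives bisections.

For exact data, `D α_ε` sends the Hamiltonian vector field of `g ∘ α_ε` to `ε` times that of `g`,
and `ker D β_ε` is the symplectic orthogonal of `ker D α_ε`. If `C` is a Casimir, the differential
of `C ∘ α_ε` thus vanishes on `ker D β_ε`, so `C ∘ α_ε` takes the same value at the nearby points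
`z = ι y` and `σ (β_ε z)` of one `β_ε`-fibre, which says that `C ∘ α_ε = C ∘ β_ε` on the bisection.
If `f ∘ α_ε = f' ∘ β_ε` on a Lagrangian bisection, the difference of the Hamiltonian vector fields
of these two functions is tangent to it. As functions of `α_ε` and of `β_ε` Poisson commute, two
such pairs have the same brackets, so the induced map preserves `ε π` and hence `π`. For `ε = 0`
every function is a Casimir, and the induced map is the identity.

The approximate data differ from the exact ones by `O(ε^(n+1))`, and so do their differentials:
the bound says that the Taylor coefficients in `ε` up to order `n` vanish, and these may be
differentiated along `S`. The pulled-back bracket is a smooth function of the values and the first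
derivatives of the maps, so the error survives, and properness makes it uniform on compact sets.
-/

namespace PoissonRealization

open Filter Asymptotics

section TaylorExpansion

variable {G : Type*} [NormedAddCommGroup G] [NormedSpace ℝ G] {I : Set ℝ}

theorem neBot_nhdsWithin_diff_singleton_zero (hI : Convex ℝ I) (hI' : I.Nontrivial)
    (h0 : (0 : ℝ) ∈ I) : (𝓝[I \ {0}] (0 : ℝ)).NeBot :=
  accPt_principal_iff_nhdsWithin.1 (hI.isPreconnected.preperfect_of_nontrivial hI' 0 h0)

theorem eq_zero_of_pow_smul_isLittleO (hI : Convex ℝ I) (hI' : I.Nontrivial) (h0 : (0 : ℝ) ∈ I)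
    {c : G} {k : ℕ} (h : (fun x : ℝ => x ^ k • c) =o[𝓝[I] 0] fun x : ℝ => x ^ k) : c = 0 := by
  have := neBot_nhdsWithin_diff_singleton_zero hI hI' h0
  have hlim : Tendsto (fun x : ℝ => (x ^ k)⁻¹ • (x ^ k • c)) (𝓝[I \ {0}] 0) (𝓝 0) :=
    (h.mono (nhdsWithin_mono 0 sdiff_subset)).tendsto_inv_smul_nhds_zero
  refine tendsto_nhds_unique (tendsto_const_nhds.congr' ?_) hlim
  filter_upwards [self_mem_nhdsWithin] with x hx
  rw [inv_smul_smul₀ (pow_ne_zero _ hx.2)]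

theorem iteratedDerivWithin_eq_zero_of_isBigO (hI : Convex ℝ I) (hI' : I.Nontrivial)
    (h0 : (0 : ℝ) ∈ I) {h : ℝ → G} (hh : ContDiffOn ℝ ∞ h I) {k : ℕ}
    (hO : h =O[𝓝[I] 0] fun x : ℝ => x ^ k) {j : ℕ} (hj : j < k) :
    iteratedDerivWithin j h I 0 = 0 := by
  induction j using Nat.strong_induction_on with
  | _ j ih =>
    have hTaylor : (fun x => h x - ((j.factorial : ℝ)⁻¹ * x ^ j) • iteratedDerivWithin j h I 0)
        =o[𝓝[I] 0] fun x : ℝ => x ^ j := by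
      refine ((taylor_isLittleO (n := j) hI h0 (hh.of_le (by exact_mod_cast le_top))).congr_left
        fun x => ?_).congr_right fun x => by rw [sub_zero]
      rw [taylor_within_apply, Finset.sum_range_succ, Finset.sum_eq_zero, zero_add, sub_zero]
      intro i hi
      have hij := Finset.mem_range.1 hi
      rw [ih i hij (hij.trans hj), smul_zero]
    have hsmall : h =o[𝓝[I] 0] fun x : ℝ => x ^ j :=
      hO.trans_isLittleO ((isLittleO_pow_pow hj).mono nhdsWithin_le_nhds)
    have hcoeff : (j.factorial : ℝ)⁻¹ • iteratedDerivWithin j h I 0 = 0 := by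
      refine eq_zero_of_pow_smul_isLittleO hI hI' h0 (k := j)
        ((hsmall.sub hTaylor).congr_left fun x => ?_)
      rw [sub_sub_cancel, smul_smul, mul_comm]
    exact (smul_eq_zero.1 hcoeff).resolve_left (by positivity)

theorem isBigO_pow_succ_of_hasDerivWithinAt {X : Type*} [TopologicalSpace X]
    {U : Set X} (hI : Convex ℝ I) (h0 : (0 : ℝ) ∈ I) (hU : IsOpen U) {r r' : X × ℝ → G}
    (hr : ∀ u ∈ U, ∀ ε ∈ I, HasDerivWithinAt (fun t => r (u, t)) (r' (u, ε)) I ε)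
    (hr0 : ∀ u ∈ U, r (u, 0) = 0) {k : ℕ} {u₀ : X} (hu₀ : u₀ ∈ U)
    (hr' : r' =O[𝓝 u₀ ×ˢ 𝓝[I] 0] fun p => p.2 ^ k) :
    r =O[𝓝 u₀ ×ˢ 𝓝[I] 0] fun p => p.2 ^ (k + 1) := by
  obtain ⟨C, hC0, hC⟩ := hr'.exists_nonneg
  obtain ⟨p, hp, q, hq, hpq⟩ := eventually_prod_iff.1 hC.bound
  obtain ⟨δ, hδ, hq⟩ := Metric.mem_nhdsWithin_iff.1 hq
  refine IsBigO.of_bound C ?_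
  have hball : Metric.ball (0 : ℝ) δ ∩ I ∈ 𝓝[I] (0 : ℝ) :=
    inter_mem (mem_nhdsWithin_of_mem_nhds (Metric.ball_mem_nhds _ hδ)) self_mem_nhdsWithin
  filter_upwards [prod_mem_prod (inter_mem hp (hU.mem_nhds hu₀)) hball]
  rintro ⟨u, ε⟩ ⟨⟨hu : p u, huU : u ∈ U⟩, hεδ : ε ∈ Metric.ball 0 δ, hεI : ε ∈ I⟩
  have hsub : segment ℝ 0 ε ⊆ I := hI.segment_subset h0 hεI
  have hle : ∀ t ∈ segment ℝ 0 ε, ‖t‖ ≤ ‖ε‖ := fun t ht => by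
    simpa using segment_subset_closedBall_left (0 : ℝ) ε ht
  have hbound : ∀ t ∈ segment ℝ 0 ε, ‖r' (u, t)‖ ≤ C * ‖ε‖ ^ k := fun t ht => by
    have htδ : t ∈ Metric.ball (0 : ℝ) δ := by
      rw [mem_ball_zero_iff] at hεδ ⊢
      exact (hle t ht).trans_lt hεδ
    refine (hpq hu (hq ⟨htδ, hsub ht⟩)).trans ?_
    rw [norm_pow]
    gcongr
    exact hle t ht
  have hmean := (convex_segment 0 ε).norm_image_sub_le_of_norm_hasDerivWithin_le
    (fun t ht => (hr u huU t (hsub ht)).mono hsub) hbound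
    (left_mem_segment ℝ 0 ε) (right_mem_segment ℝ 0 ε)
  simpa only [hr0 u huU, sub_zero, norm_mul, norm_pow, pow_succ, ← mul_assoc] using hmean

end TaylorExpansion

section ParametricTaylorExpansion

variable {E : Type*} [NormedAddCommGroup E] [NormedSpace ℝ E]
  {G : Type*} [NormedAddCommGroup G] [NormedSpace ℝ G] {I : Set ℝ} {U : Set E} {r : E × ℝ → G}

theorem hasDerivWithinAt_slice (hr : ContDiffOn ℝ ∞ r (U ×ˢ I)) {u : E} (hu : u ∈ U) {ε : ℝ}
    (hε : ε ∈ I) :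
    HasDerivWithinAt (fun t => r (u, t)) (fderivWithin ℝ r (U ×ˢ I) (u, ε) (0, 1)) I ε :=
  (hr.differentiableOn (by simp) (u, ε) ⟨hu, hε⟩).hasFDerivWithinAt.comp_hasDerivWithinAt ε
    ((hasDerivWithinAt_const ε I u).prodMk (hasDerivWithinAt_id ε I)) fun _ ht => ⟨hu, ht⟩

theorem hasFDerivAt_slice (hU : IsOpen U) (hr : ContDiffOn ℝ ∞ r (U ×ˢ I)) {u : E} (hu : u ∈ U)
    {ε : ℝ} (hε : ε ∈ I) :
    HasFDerivAt (fun v => r (v, ε))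
      ((fderivWithin ℝ r (U ×ˢ I) (u, ε)).comp (ContinuousLinearMap.inl ℝ E ℝ)) u :=
  ((hr.differentiableOn (by simp) (u, ε) ⟨hu, hε⟩).hasFDerivWithinAt.comp (s := U) u
    (f := fun v : E => (v, ε)) (hasFDerivAt_prodMk_left u ε).hasFDerivWithinAt
    fun _ hv => ⟨hv, hε⟩).hasFDerivAt (hU.mem_nhds hu)

theorem uniqueDiffOn_of_convex_of_nontrivial (hI : Convex ℝ I) (hI' : I.Nontrivial) :
    UniqueDiffOn ℝ I :=
  uniqueDiffOn_convex hI (hI.nontrivial_iff_nonempty_interior.1 hI')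

theorem isSymmSndFDerivWithinAt_prod_convex (hI : Convex ℝ I) (hI' : I.Nontrivial) (hU : IsOpen U)
    (hr : ContDiffOn ℝ ∞ r (U ×ˢ I)) {p : E × ℝ} (hp : p ∈ U ×ˢ I) :
    IsSymmSndFDerivWithinAt ℝ r (U ×ˢ I) p := by
  have hclosure : p ∈ closure (interior (U ×ˢ I)) := by
    rw [interior_prod_eq, closure_prod_eq, hU.interior_eq,
      hI.closure_interior_eq_closure_of_nonempty_interior
        (hI.nontrivial_iff_nonempty_interior.1 hI')]
    exact ⟨subset_closure hp.1, subset_closure hp.2⟩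
  refine (hr p hp).isSymmSndFDerivWithinAt ?_
    (hU.uniqueDiffOn.prod (uniqueDiffOn_of_convex_of_nontrivial hI hI')) hclosure hp
  rw [minSmoothness_of_isRCLikeNormedField]
  exact WithTop.coe_le_coe.2 le_top

theorem hasDerivWithinAt_fderivWithin_comp_inl (hI : Convex ℝ I) (hI' : I.Nontrivial)
    (hU : IsOpen U) (hr : ContDiffOn ℝ ∞ r (U ×ˢ I)) {u : E} (hu : u ∈ U) {ε : ℝ} (hε : ε ∈ I) :
    HasDerivWithinAt
      (fun t => (fderivWithin ℝ r (U ×ˢ I) (u, t)).comp (ContinuousLinearMap.inl ℝ E ℝ))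
      ((fderivWithin ℝ (fun p => fderivWithin ℝ r (U ×ˢ I) p (0, 1)) (U ×ˢ I) (u, ε)).comp
        (ContinuousLinearMap.inl ℝ E ℝ)) I ε := by
  have hs := hU.uniqueDiffOn.prod (uniqueDiffOn_of_convex_of_nontrivial hI hI')
  have hdr : ContDiffOn ℝ ∞ (fderivWithin ℝ r (U ×ˢ I)) (U ×ˢ I) := hr.fderivWithin hs (by simp)
  have hflip : fderivWithin ℝ (fun p => fderivWithin ℝ r (U ×ˢ I) p (0, 1)) (U ×ˢ I) (u, ε)
      = (fderivWithin ℝ (fderivWithin ℝ r (U ×ˢ I)) (U ×ˢ I) (u, ε)).flip (0, 1) := by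
    rw [fderivWithin_clm_apply (hs _ ⟨hu, hε⟩)
      (hdr.differentiableOn (by simp) _ ⟨hu, hε⟩) (differentiableWithinAt_const _)]
    simp
  refine (((ContinuousLinearMap.compL ℝ E (E × ℝ) G).flip
    (ContinuousLinearMap.inl ℝ E ℝ)).hasFDerivAt.comp_hasDerivWithinAt ε
      (hasDerivWithinAt_slice hdr hu hε)).congr_deriv ?_
  ext v
  rw [hflip]
  simpa using isSymmSndFDerivWithinAt_prod_convex hI hI' hU hr ⟨hu, hε⟩ (0, 1) (v, 0)

theorem fderivWithin_comp_inl_isBigO (hI : Convex ℝ I) (hI' : I.Nontrivial) (h0 : (0 : ℝ) ∈ I)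
    (hU : IsOpen U) (hr : ContDiffOn ℝ ∞ r (U ×ˢ I)) {k : ℕ}
    (hr0 : ∀ u ∈ U, ∀ j < k, iteratedDerivWithin j (fun ε => r (u, ε)) I 0 = 0)
    {u₀ : E} (hu₀ : u₀ ∈ U) :
    (fun p => (fderivWithin ℝ r (U ×ˢ I) p).comp (ContinuousLinearMap.inl ℝ E ℝ))
      =O[𝓝 u₀ ×ˢ 𝓝[I] 0] (fun p => p.2 ^ k) := by
  have hI'' := uniqueDiffOn_of_convex_of_nontrivial hI hI'
  have hs : UniqueDiffOn ℝ (U ×ˢ I) := hU.uniqueDiffOn.prod hI''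
  induction k generalizing r with
  | zero =>
    simp only [pow_zero]
    rw [← hU.nhdsWithin_eq hu₀, ← nhdsWithin_prod_eq]
    exact ((hr.continuousOn_fderivWithin hs (by simp) (u₀, 0) ⟨hu₀, h0⟩).clm_comp
      continuousWithinAt_const).tendsto.isBigO_one ℝ
  | succ k ih =>
    have hdr : ContDiffOn ℝ ∞ (fun p => fderivWithin ℝ r (U ×ˢ I) p (0, 1)) (U ×ˢ I) :=
      (hr.fderivWithin hs (by simp)).clm_apply contDiffOn_const
    refine isBigO_pow_succ_of_hasDerivWithinAt hI h0 hU
      (fun u hu ε hε => hasDerivWithinAt_fderivWithin_comp_inl hI hI' hU hr hu hε)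
      (fun u hu => ?_) hu₀ (ih hdr fun u hu j hj => ?_)
    · have hzero : (fun v => r (v, 0)) =ᶠ[𝓝 u] fun _ => 0 := by
        filter_upwards [hU.mem_nhds hu] with v hv
        simpa using hr0 v hv 0 k.succ_pos
      exact (hasFDerivAt_slice hU hr hu h0).unique
        ((hasFDerivAt_const 0 u).congr_of_eventuallyEq hzero)
    · rw [← hr0 u hu (j + 1) (by lia), iteratedDerivWithin_succ']
      exact iteratedDerivWithin_congr
        (fun ε hε => ((hasDerivWithinAt_slice hr hu hε).derivWithin (hI'' ε hε)).symm) h0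

theorem fderiv_slice_isBigO (hI : Convex ℝ I) (hI' : I.Nontrivial) (h0 : (0 : ℝ) ∈ I)
    (hU : IsOpen U) (hr : ContDiffOn ℝ ∞ r (U ×ˢ I)) {k : ℕ}
    (hO : ∀ u ∈ U, (fun ε => r (u, ε)) =O[𝓝[I] 0] fun ε : ℝ => ε ^ k) {u₀ : E} (hu₀ : u₀ ∈ U) :
    (fun p : E × ℝ => fderiv ℝ (fun v => r (v, p.2)) p.1)
      =O[𝓝 u₀ ×ˢ 𝓝[I] 0] (fun p => p.2 ^ k) := by
  refine (fderivWithin_comp_inl_isBigO hI hI' h0 hU hr (fun u hu j hj =>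
    iteratedDerivWithin_eq_zero_of_isBigO hI hI' h0
      (hr.comp (contDiff_prodMk_right u).contDiffOn fun t ht => ⟨hu, ht⟩) (hO u hu) hj)
    hu₀).congr' ?_ EventuallyEq.rfl
  filter_upwards [prod_mem_prod (hU.mem_nhds hu₀) self_mem_nhdsWithin] with p hp
  exact (hasFDerivAt_slice hU hr hp.1 hp.2).fderiv.symm

end ParametricTaylorExpansion

section PullbackTrivialization

variable {B B' F : Type*} {V : B → Type*} [TopologicalSpace B] [TopologicalSpace B']
  [NormedAddCommGroup F] [NormedSpace ℝ F] [TopologicalSpace (TotalSpace F V)]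
  [∀ b, AddCommMonoid (V b)] [∀ b, Module ℝ (V b)] [∀ b, TopologicalSpace (V b)]
  [FiberBundle F V] [VectorBundle ℝ F V]
  (f : C(B', B)) (b₀ : B') {b : B'}

theorem continuousLinearMapAt_trivializationAt_pullback
    (hb : f b ∈ (trivializationAt F V (f b₀)).baseSet) (w : V (f b)) :
    (trivializationAt F (f *ᵖ V) b₀).continuousLinearMapAt ℝ b w =
      (trivializationAt F V (f b₀)).continuousLinearMapAt ℝ (f b) w :=
  (congrFun ((trivializationAt F (f *ᵖ V) b₀).coe_linearMapAt_of_mem (R := ℝ) (b := b) hb) w).trans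
    (congrFun ((trivializationAt F V (f b₀)).coe_linearMapAt_of_mem (R := ℝ) hb) w).symm

theorem symmL_trivializationAt_pullback
    (hb : f b ∈ (trivializationAt F V (f b₀)).baseSet) (v : F) :
    (trivializationAt F (f *ᵖ V) b₀).symmL ℝ b v =
      (trivializationAt F V (f b₀)).symmL ℝ (f b) v := by
  set w := (trivializationAt F (f *ᵖ V) b₀).symmL ℝ b v
  have hw : (trivializationAt F V (f b₀)).continuousLinearMapAt ℝ (f b) w = v :=
    (continuousLinearMapAt_trivializationAt_pullback f b₀ hb w).symm.trans
      ((trivializationAt F (f *ᵖ V) b₀).continuousLinearMapAt_symmL (R := ℝ) (b := b) hb v)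
  exact ((trivializationAt F V (f b₀)).symmL_continuousLinearMapAt (R := ℝ) hb w).symm.trans
    (congrArg _ hw)

end PullbackTrivialization

section ModelDerivative

variable {E : Type*} [NormedAddCommGroup E] [NormedSpace ℝ E]
  {M : Type*} [TopologicalSpace M] [ChartedSpace E M]
  {F : Type*} [NormedAddCommGroup F] [NormedSpace ℝ F]
  {S : Type*} [TopologicalSpace S] [ChartedSpace F S]
  {G : Type*} [NormedAddCommGroup G] [NormedSpace ℝ G]
  {N : Type*} [TopologicalSpace N] [ChartedSpace G N]

/-- The differential `D_z f`, as a linear map between the model spaces `F` and `E`: the tangent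
spaces are identified with them by the preferred charts at `z` and at `f z`. With this type,
differentials at different points can be composed and compared. -/
noncomputable def modelDeriv (F : Type*) [NormedAddCommGroup F] [NormedSpace ℝ F]
    (E : Type*) [NormedAddCommGroup E] [NormedSpace ℝ E]
    {S : Type*} [TopologicalSpace S] [ChartedSpace F S]
    {M : Type*} [TopologicalSpace M] [ChartedSpace E M] (f : S → M) (z : S) : F →L[ℝ] E :=
  mfderiv 𝓘(ℝ, F) 𝓘(ℝ, E) f z

theorem modelDeriv_congr {f g : S → M} {z : S} (h : f =ᶠ[𝓝 z] g) :
    modelDeriv F E f z = modelDeriv F E g z :=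
  h.mfderiv_eq (I := 𝓘(ℝ, F)) (I' := 𝓘(ℝ, E))

theorem modelDeriv_comp {g : M → N} {f : S → M} {z : S}
    (hg : MDifferentiableAt 𝓘(ℝ, E) 𝓘(ℝ, G) g (f z))
    (hf : MDifferentiableAt 𝓘(ℝ, F) 𝓘(ℝ, E) f z) :
    modelDeriv F G (g ∘ f) z = (modelDeriv E G g (f z)).comp (modelDeriv F E f z) :=
  mfderiv_comp z hg hf

theorem modelDeriv_id (x : M) : modelDeriv E E id x = .id ℝ E :=
  mfderiv_id

theorem modelDeriv_eq_fderiv (f : F → E) (z : F) : modelDeriv F E f z = fderiv ℝ f z :=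
  mfderiv_eq_fderiv

/-- The linear map of a 1-jet, between the model spaces. -/
def jetMap (j : OneJets E M F S) : E →L[ℝ] F := j.snd

theorem proj_oneJet (f : M → S) (x : M) : (oneJet f x : OneJets E M F S).proj = (x, f x) := rfl

theorem jetMap_oneJet (f : M → S) (x : M) : jetMap (oneJet f x) = modelDeriv E F f x := rfl

variable [IsManifold 𝓘(ℝ, E) ∞ M] [IsManifold 𝓘(ℝ, F) ∞ S]

/-- The isomorphism `T_x M → T_{x₀} M` given by the preferred chart at `x₀`, for `x` in its
domain. -/
noncomputable def tangentCoord (x₀ x : M) : E →L[ℝ] E :=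
  (trivializationAt E (TangentSpace 𝓘(ℝ, E)) x₀).continuousLinearMapAt ℝ x

/-- The inverse of `tangentCoord x₀ x`. -/
noncomputable def tangentCoordSymm (x₀ x : M) : E →L[ℝ] E :=
  (trivializationAt E (TangentSpace 𝓘(ℝ, E)) x₀).symmL ℝ x

theorem tangentCoord_comp_tangentCoordSymm {x₀ x : M} (hx : x ∈ (chartAt E x₀).source) :
    (tangentCoord x₀ x).comp (tangentCoordSymm x₀ x) = .id ℝ E :=
  ContinuousLinearMap.ext <| (trivializationAt E
    (TangentSpace 𝓘(ℝ, E)) x₀).continuousLinearMapAt_symmL (R := ℝ) (b := x) hx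

theorem tangentCoordSymm_comp_tangentCoord {x₀ x : M} (hx : x ∈ (chartAt E x₀).source) :
    (tangentCoordSymm x₀ x).comp (tangentCoord x₀ x) = .id ℝ E :=
  ContinuousLinearMap.ext <| (trivializationAt E
    (TangentSpace 𝓘(ℝ, E)) x₀).symmL_continuousLinearMapAt (R := ℝ) (b := x) hx

theorem isInvertible_tangentCoord {x₀ x : M} (hx : x ∈ (chartAt E x₀).source) :
    (tangentCoord (E := E) x₀ x).IsInvertible :=
  .of_inverse (tangentCoord_comp_tangentCoordSymm hx) (tangentCoordSymm_comp_tangentCoord hx)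

theorem isInvertible_tangentCoordSymm {x₀ x : M} (hx : x ∈ (chartAt E x₀).source) :
    (tangentCoordSymm (E := E) x₀ x).IsInvertible :=
  .of_inverse (tangentCoordSymm_comp_tangentCoord hx) (tangentCoord_comp_tangentCoordSymm hx)

theorem tangentCoord_modelSpace (v w : G) : tangentCoord v w = .id ℝ G :=
  TangentBundle.continuousLinearMapAt_model_space v w

theorem tangentCoord_eq_modelDeriv {x₀ x : M} (hx : x ∈ (chartAt E x₀).source) :
    tangentCoord x₀ x = modelDeriv E E (extChartAt 𝓘(ℝ, E) x₀) x :=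
  TangentBundle.continuousLinearMapAt_trivializationAt (I := 𝓘(ℝ, E)) hx

theorem eventually_modelDeriv_eq_tangentCoord {x₀ x : M} (hx : x ∈ (chartAt E x₀).source)
    {Φ : M → E} (hΦ : Φ =ᶠ[𝓝 x] extChartAt 𝓘(ℝ, E) x₀) :
    ∀ᶠ y in 𝓝 x, modelDeriv E E Φ y = tangentCoord x₀ y := by
  filter_upwards [hΦ.eventually_nhds, (chartAt E x₀).open_source.mem_nhds hx] with y hy hyc
  rw [modelDeriv_congr hy, tangentCoord_eq_modelDeriv hyc]

theorem tangentCoordSymm_eq_modelDeriv {x₀ x : M} (hx : x ∈ (chartAt E x₀).source) :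
    tangentCoordSymm x₀ x =
      modelDeriv E E (extChartAt 𝓘(ℝ, E) x₀).symm (extChartAt 𝓘(ℝ, E) x₀ x) := by
  have h := TangentBundle.symmL_trivializationAt (I := 𝓘(ℝ, E)) hx
  rwa [ModelWithCorners.range_eq_univ, mfderivWithin_univ] at h

theorem hasFDerivAt_comp_extChartAt_symm {h : M → G} {x₀ x : M}
    (hh : MDifferentiableAt 𝓘(ℝ, E) 𝓘(ℝ, G) h x) (hx : x ∈ (chartAt E x₀).source) :
    HasFDerivAt (h ∘ (extChartAt 𝓘(ℝ, E) x₀).symm)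
      ((modelDeriv E G h x).comp (tangentCoordSymm x₀ x)) (extChartAt 𝓘(ℝ, E) x₀ x) := by
  have hxs : x ∈ (extChartAt 𝓘(ℝ, E) x₀).source := by rwa [extChartAt_source]
  have hsymm : MDifferentiableAt 𝓘(ℝ, E) 𝓘(ℝ, E) (extChartAt 𝓘(ℝ, E) x₀).symm
      (extChartAt 𝓘(ℝ, E) x₀ x) :=
    ((contMDiffOn_extChartAt_symm (n := ∞) (I := 𝓘(ℝ, E)) x₀).contMDiffAt
      ((isOpen_extChartAt_target x₀).mem_nhds
        ((extChartAt 𝓘(ℝ, E) x₀).map_source hxs))).mdifferentiableAt (by simp)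
  have hinv := (extChartAt 𝓘(ℝ, E) x₀).left_inv hxs
  have hh' := hinv.symm ▸ hh
  have hderiv := (mdifferentiableAt_iff_differentiableAt.1 (hh'.comp _ hsymm)).hasFDerivAt
  rwa [← modelDeriv_eq_fderiv, modelDeriv_comp hh' hsymm, hinv,
    ← tangentCoordSymm_eq_modelDeriv hx] at hderiv

theorem fderiv_comp_extChartAt_symm {h : M → G} {x₀ x : M}
    (hh : MDifferentiableAt 𝓘(ℝ, E) 𝓘(ℝ, G) h x) (hx : x ∈ (chartAt E x₀).source) :
    fderiv ℝ (h ∘ (extChartAt 𝓘(ℝ, E) x₀).symm) (extChartAt 𝓘(ℝ, E) x₀ x) =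
      (modelDeriv E G h x).comp (tangentCoordSymm x₀ x) :=
  (hasFDerivAt_comp_extChartAt_symm hh hx).fderiv

theorem hasFDerivAt_comp_extChartAt_symm_of_mem_target {h : M → G} {x₀ : M} {w : E}
    (hw : w ∈ (extChartAt 𝓘(ℝ, E) x₀).target)
    (hh : MDifferentiableAt 𝓘(ℝ, E) 𝓘(ℝ, G) h ((extChartAt 𝓘(ℝ, E) x₀).symm w)) :
    HasFDerivAt (h ∘ (extChartAt 𝓘(ℝ, E) x₀).symm)
      ((modelDeriv E G h ((extChartAt 𝓘(ℝ, E) x₀).symm w)).comp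
        (tangentCoordSymm x₀ ((extChartAt 𝓘(ℝ, E) x₀).symm w))) w := by
  have hderiv := hasFDerivAt_comp_extChartAt_symm (x₀ := x₀) hh
    (extChartAt_source 𝓘(ℝ, E) x₀ ▸ (extChartAt 𝓘(ℝ, E) x₀).map_target hw)
  rwa [(extChartAt 𝓘(ℝ, E) x₀).right_inv hw] at hderiv

theorem continuous_proj_oneJets : Continuous (fun j : OneJets E M F S => j.proj) :=
  FiberBundle.continuous_proj _ _

theorem continuousAt_jetMap_inCoordinates (j₀ : OneJets E M F S) :
    ContinuousAt (fun j : OneJets E M F S =>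
      (tangentCoord j₀.proj.2 j.proj.2).comp
        ((jetMap j).comp (tangentCoordSymm j₀.proj.1 j.proj.1))) j₀ := by
  have h := (continuousAt_hom_bundle (σ := RingHom.id ℝ) (F₁ := E) (F₂ := F)
    (E₁ := (ContinuousMap.fst : C(M × S, M)) *ᵖ (TangentSpace 𝓘(ℝ, E) : M → Type _))
    (E₂ := (ContinuousMap.snd : C(M × S, S)) *ᵖ (TangentSpace 𝓘(ℝ, F) : S → Type _))
    (f := id) (x₀ := j₀)).1 continuousAt_id
  refine h.2.congr ?_
  have hproj := (continuous_proj_oneJets (E := E) (M := M) (F := F) (S := S)).tendsto j₀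
  filter_upwards [hproj.fst_nhds.eventually (chart_source_mem_nhds E j₀.proj.1),
    hproj.snd_nhds.eventually (chart_source_mem_nhds F j₀.proj.2)] with j hfst hsnd
  ext v
  exact (continuousLinearMapAt_trivializationAt_pullback ContinuousMap.snd j₀.proj hsnd _).trans
    (congrArg _ (congrArg _ (symmL_trivializationAt_pullback ContinuousMap.fst j₀.proj hfst v)))

end ModelDerivative

section Families

variable {E : Type*} [NormedAddCommGroup E] [NormedSpace ℝ E]
  {M : Type*} [TopologicalSpace M] [ChartedSpace E M]
  {F : Type*} [NormedAddCommGroup F] [NormedSpace ℝ F]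
  {S : Type*} [TopologicalSpace S] [ChartedSpace F S]
  {G : Type*} [NormedAddCommGroup G] [NormedSpace ℝ G]
  {N : Type*} [TopologicalSpace N] [ChartedSpace G N]
  {I : Set ℝ} {ε₀ : ℝ}

theorem IsSmoothFamily.contMDiff {γ : ℝ → S → M} (hγ : IsSmoothFamily F E I γ) {ε : ℝ}
    (hε : ε ∈ I) : ContMDiff 𝓘(ℝ, F) 𝓘(ℝ, E) ∞ (γ ε) := by
  have hslice : ContMDiff 𝓘(ℝ, F) (𝓘(ℝ, F).prod 𝓘(ℝ, ℝ)) ∞ (fun z : S => (z, ε)) :=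
    contMDiff_id.prodMk contMDiff_const
  exact ContMDiffOn.comp_contMDiff (g := fun p : S × ℝ => γ p.2 p.1) hγ hslice
    fun z => ⟨mem_univ z, hε⟩

theorem IsSmoothFamily.mdifferentiableAt {γ : ℝ → S → M} (hγ : IsSmoothFamily F E I γ) {ε : ℝ}
    (hε : ε ∈ I) (z : S) : MDifferentiableAt 𝓘(ℝ, F) 𝓘(ℝ, E) (γ ε) z :=
  (hγ.contMDiff hε).mdifferentiableAt (by simp)

theorem IsSmoothFamily.comp_left {γ : ℝ → S → M} (hγ : IsSmoothFamily F E I γ) {Φ : M → N}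
    (hΦ : ContMDiff 𝓘(ℝ, E) 𝓘(ℝ, G) ∞ Φ) : IsSmoothFamily F G I (fun ε => Φ ∘ γ ε) :=
  hΦ.comp_contMDiffOn hγ

theorem IsSmoothFamily.comp_right {γ : ℝ → S → M} (hγ : IsSmoothFamily F E I γ) {ι : N → S}
    (hι : ContMDiff 𝓘(ℝ, G) 𝓘(ℝ, F) ∞ ι) : IsSmoothFamily G E I (fun ε => γ ε ∘ ι) := by
  have hprod : ContMDiff (𝓘(ℝ, G).prod 𝓘(ℝ, ℝ)) (𝓘(ℝ, F).prod 𝓘(ℝ, ℝ)) ∞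
      (fun p : N × ℝ => (ι p.1, p.2)) :=
    (hι.comp contMDiff_fst).prodMk contMDiff_snd
  exact ContMDiffOn.comp (g := fun p : S × ℝ => γ p.2 p.1) hγ hprod.contMDiffOn
    fun p hp => ⟨mem_univ _, hp.2⟩

theorem IsSmoothFamily.tendsto {γ : ℝ → S → M} (hγ : IsSmoothFamily F E I γ) (hε₀ : ε₀ ∈ I)
    (z₀ : S) :
    Tendsto (fun p : S × ℝ => γ p.2 p.1) (𝓝 z₀ ×ˢ 𝓝[I] ε₀) (𝓝 (γ ε₀ z₀)) := by
  rw [← nhdsWithin_univ, ← nhdsWithin_prod_eq]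
  exact hγ.continuousOn (z₀, ε₀) ⟨mem_univ _, hε₀⟩

theorem IsSmoothFamily.contDiffOn_inChart [IsManifold 𝓘(ℝ, F) ∞ S] {h : ℝ → S → G}
    (hh : IsSmoothFamily F G I h) (z₀ : S) :
    ContDiffOn ℝ ∞ (fun p : F × ℝ => h p.2 ((extChartAt 𝓘(ℝ, F) z₀).symm p.1))
      ((extChartAt 𝓘(ℝ, F) z₀).target ×ˢ I) := by
  rw [← contMDiffOn_iff_contDiffOn, modelWithCornersSelf_prod, ← chartedSpaceSelf_prod]
  have hchart : ContMDiffOn (𝓘(ℝ, F).prod 𝓘(ℝ, ℝ)) (𝓘(ℝ, F).prod 𝓘(ℝ, ℝ)) ∞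
      (fun p : F × ℝ => ((extChartAt 𝓘(ℝ, F) z₀).symm p.1, p.2))
      ((extChartAt 𝓘(ℝ, F) z₀).target ×ˢ I) :=
    ((contMDiffOn_extChartAt_symm z₀).comp contMDiffOn_fst fun p hp => hp.1).prodMk contMDiffOn_snd
  exact ContMDiffOn.comp (g := fun p : S × ℝ => h p.2 p.1) hh hchart fun p hp => ⟨mem_univ _, hp.2⟩

theorem IsSmoothFamily.tendsto_modelDeriv [IsManifold 𝓘(ℝ, E) ∞ M] [IsManifold 𝓘(ℝ, F) ∞ S]
    {γ : ℝ → S → M} (hγ : IsSmoothFamily F E I γ) (hε₀ : ε₀ ∈ I) (z₀ : S) :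
    Tendsto (fun p : S × ℝ => (tangentCoord (γ ε₀ z₀) (γ p.2 p.1)).comp
        ((modelDeriv F E (γ p.2) p.1).comp (tangentCoordSymm z₀ p.1)))
      (𝓝 z₀ ×ˢ 𝓝[I] ε₀)
      (𝓝 ((tangentCoord (γ ε₀ z₀) (γ ε₀ z₀)).comp
        ((modelDeriv F E (γ ε₀) z₀).comp (tangentCoordSymm z₀ z₀)))) := by
  have hjoint : ContMDiffOn ((𝓘(ℝ, F).prod 𝓘(ℝ, ℝ)).prod 𝓘(ℝ, F)) 𝓘(ℝ, E) ∞
      (Function.uncurry fun (p : S × ℝ) z => γ p.2 z) ((univ ×ˢ I) ×ˢ univ) :=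
    ContMDiffOn.comp (g := fun p : S × ℝ => γ p.2 p.1) hγ
      (contMDiff_snd.prodMk (contMDiff_snd.comp contMDiff_fst)).contMDiffOn
      fun p hp => ⟨mem_univ _, hp.1.2⟩
  have hmem : (z₀, ε₀) ∈ univ ×ˢ I := ⟨mem_univ z₀, hε₀⟩
  have hderiv := ContMDiffWithinAt.mfderivWithin (m := 0) (f := fun (p : S × ℝ) z => γ p.2 z)
    (g := Prod.fst) (hjoint ((z₀, ε₀), z₀) ⟨hmem, mem_univ _⟩)
    contMDiffWithinAt_fst hmem (mapsTo_univ _ _) (by simp) uniqueMDiffOn_univ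
  rw [← nhdsWithin_univ, ← nhdsWithin_prod_eq]
  have := hderiv.continuousWithinAt.tendsto
  simp only [mfderivWithin_univ] at this
  exact this

theorem IsSmoothFamily.tendsto_modelDeriv_vector [IsManifold 𝓘(ℝ, F) ∞ S] {h : ℝ → S → G}
    (hh : IsSmoothFamily F G I h) (hε₀ : ε₀ ∈ I) (z₀ : S) :
    Tendsto (fun p : S × ℝ => (modelDeriv F G (h p.2) p.1).comp (tangentCoordSymm z₀ p.1))
      (𝓝 z₀ ×ˢ 𝓝[I] ε₀) (𝓝 ((modelDeriv F G (h ε₀) z₀).comp (tangentCoordSymm z₀ z₀))) := by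
  simpa only [tangentCoord_modelSpace, ContinuousLinearMap.id_comp] using
    hh.tendsto_modelDeriv hε₀ z₀

theorem IsSmoothFamily.modelDeriv_sub_isBigO [IsManifold 𝓘(ℝ, F) ∞ S] (hI : Convex ℝ I)
    (hI' : I.Nontrivial) (h0 : (0 : ℝ) ∈ I) {h h' : ℝ → S → G} (hh : IsSmoothFamily F G I h)
    (hh' : IsSmoothFamily F G I h') {k : ℕ}
    (hO : ∀ z, (fun ε => h ε z - h' ε z) =O[𝓝[I] 0] (fun ε => ε ^ k)) (z₀ : S) :
    (fun p : S × ℝ => (modelDeriv F G (h p.2) p.1).comp (tangentCoordSymm z₀ p.1) -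
      (modelDeriv F G (h' p.2) p.1).comp (tangentCoordSymm z₀ p.1))
      =O[𝓝 z₀ ×ˢ 𝓝[I] 0] (fun p => p.2 ^ k) := by
  set ψ := extChartAt 𝓘(ℝ, F) z₀
  have hU : IsOpen ψ.target := isOpen_extChartAt_target z₀
  have hr := (hh.contDiffOn_inChart z₀).sub (hh'.contDiffOn_inChart z₀)
  have hchart := fderiv_slice_isBigO hI hI' h0 hU hr (fun u _ => hO (ψ.symm u))
    (mem_extChartAt_target z₀)
  have hψ : Tendsto (fun p : S × ℝ => (ψ p.1, p.2)) (𝓝 z₀ ×ˢ 𝓝[I] 0) (𝓝 (ψ z₀) ×ˢ 𝓝[I] 0) :=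
    (continuousAt_extChartAt z₀).tendsto.prodMap tendsto_id
  refine (hchart.comp_tendsto hψ).congr' ?_ .rfl
  filter_upwards [prod_mem_prod (chart_source_mem_nhds F z₀) self_mem_nhdsWithin] with p hp
  have hu : ψ p.1 ∈ ψ.target := ψ.map_source (by rw [extChartAt_source]; exact hp.1)
  rw [← fderiv_comp_extChartAt_symm (hh.mdifferentiableAt hp.2 p.1) hp.1,
    ← fderiv_comp_extChartAt_symm (hh'.mdifferentiableAt hp.2 p.1) hp.1]
  exact fderiv_sub (hasFDerivAt_slice hU (hh.contDiffOn_inChart z₀) hu hp.2).differentiableAt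
    (hasFDerivAt_slice hU (hh'.contDiffOn_inChart z₀) hu hp.2).differentiableAt

theorem exists_contMDiff_eventuallyEq_extChartAt [FiniteDimensional ℝ E] [T2Space M]
    [IsManifold 𝓘(ℝ, E) ∞ M] {c x₀ : M} (hx₀ : x₀ ∈ (chartAt E c).source) :
    ∃ Φ : M → E, ContMDiff 𝓘(ℝ, E) 𝓘(ℝ, E) ∞ Φ ∧ Φ =ᶠ[𝓝 x₀] extChartAt 𝓘(ℝ, E) c := by
  obtain ⟨f, -, hf⟩ := (SmoothBumpFunction.nhds_basis_tsupport (I := 𝓘(ℝ, E)) x₀).mem_iff.1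
    ((chartAt E c).open_source.mem_nhds hx₀)
  refine ⟨fun x => f x • extChartAt 𝓘(ℝ, E) c x, contMDiff_of_tsupport fun x hx => ?_, ?_⟩
  · exact f.contMDiffAt.smul (contMDiffAt_extChartAt'
      (hf (closure_mono (Function.support_smul_subset_left _ _) hx)))
  · filter_upwards [f.eventuallyEq_one] with x hx
    simp [hx]

end Families

section InverseFunction

variable {E : Type*} [NormedAddCommGroup E] [NormedSpace ℝ E] [CompleteSpace E]

theorem exists_openPartialHomeomorph_of_contDiffOn {F : Type*} [NormedAddCommGroup F]
    [NormedSpace ℝ F] {f : E → F} {U : Set E} (hU : IsOpen U) (hf : ContDiffOn ℝ ∞ f U) {x : E}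
    (hx : x ∈ U) {f' : E ≃L[ℝ] F} (hf' : HasFDerivAt f (f' : E →L[ℝ] F) x) :
    ∃ g : OpenPartialHomeomorph E F, ⇑g = f ∧ x ∈ g.source ∧ g.source ⊆ U ∧
      (∀ y ∈ g.source, ∃ L : E ≃L[ℝ] F, HasFDerivAt f (L : E →L[ℝ] F) y) ∧
      ContDiffOn ℝ ∞ g.symm g.target := by
  have hfx : ContDiffAt ℝ ∞ f x := hf.contDiffAt (hU.mem_nhds hx)
  set g₀ := hfx.toOpenPartialHomeomorph f hf' (by simp)
  set V := U ∩ fderiv ℝ f ⁻¹' range ((↑) : (E ≃L[ℝ] F) → E →L[ℝ] F)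
  have hV : IsOpen V := (hf.continuousOn_fderiv_of_isOpen hU (by simp)).isOpen_inter_preimage hU
    ContinuousLinearEquiv.isOpen
  have hderiv : ∀ y ∈ V, ∃ L : E ≃L[ℝ] F, HasFDerivAt f (L : E →L[ℝ] F) y := by
    rintro y ⟨hy, L, hL⟩
    refine ⟨L, hL ▸ DifferentiableAt.hasFDerivAt ?_⟩
    exact (hf.contDiffAt (hU.mem_nhds hy)).differentiableAt (by simp)
  refine ⟨g₀.restrOpen V hV, rfl, ⟨hfx.mem_toOpenPartialHomeomorph_source hf' (by simp), hx, f',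
    hf'.fderiv.symm⟩, fun y hy => hy.2.1, fun y hy => hderiv y hy.2, fun y hy => ?_⟩
  have hsource := (g₀.restrOpen V hV).map_target hy
  obtain ⟨L, hL⟩ := hderiv _ hsource.2
  exact ((g₀.restrOpen V hV).contDiffAt_symm hy hL
    (hf.contDiffAt (hU.mem_nhds hsource.2.1))).contDiffWithinAt

variable {M : Type*} [TopologicalSpace M] [ChartedSpace E M] [IsManifold 𝓘(ℝ, E) ∞ M]
  {N : Type*} [TopologicalSpace N] [ChartedSpace E N] [IsManifold 𝓘(ℝ, E) ∞ N]

theorem isLocalDiffeomorphAt_of_isInvertible_modelDeriv {b : M → N}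
    (hb : ContMDiff 𝓘(ℝ, E) 𝓘(ℝ, E) ∞ b) {x : M} (hx : (modelDeriv E E b x).IsInvertible) :
    IsLocalDiffeomorphAt 𝓘(ℝ, E) 𝓘(ℝ, E) ∞ b x := by
  set φ := chartAt E x
  set ψ := chartAt E (b x)
  set U := φ.symm.source ∩ φ.symm ⁻¹' (b ⁻¹' ψ.source)
  have hU : IsOpen U := φ.symm.isOpen_inter_preimage (ψ.open_source.preimage hb.continuous)
  have hxs : x ∈ φ.source := mem_chart_source E x
  have hφx : φ.symm (φ x) = x := φ.left_inv hxs
  have hxU : φ x ∈ U := ⟨φ.map_source hxs, by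
    rw [mem_preimage, hφx]; exact mem_chart_source E (b x)⟩
  have hf : ContDiffOn ℝ ∞ (ψ ∘ b ∘ φ.symm) U := by
    rw [← contMDiffOn_iff_contDiffOn]
    exact contMDiffOn_chart.comp (hb.comp_contMDiffOn (contMDiffOn_chart_symm.mono
      inter_subset_left)) fun w hw => hw.2
  obtain ⟨L, hL⟩ := hx
  have hderiv : HasFDerivAt (ψ ∘ b ∘ φ.symm) (L : E →L[ℝ] E) (φ x) := by
    have h := (hb.mdifferentiable (by simp) x).mfderiv
    simp only [modelWithCornersSelf_coe, range_id, fderivWithin_univ] at h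
    rw [hL, modelDeriv, h]
    exact ((hf.contDiffAt (hU.mem_nhds hxU)).differentiableAt (by simp)).hasFDerivAt
  obtain ⟨g, hg, hxg, hgU, -, hgsymm⟩ :=
    exists_openPartialHomeomorph_of_contDiffOn hU hf hxU hderiv
  set e := (φ.trans g).trans ψ.symm
  have heq : EqOn b e e.source := by
    intro y hy
    have hinv : φ.symm (φ y) = y := φ.left_inv hy.1.1
    have hby : b (φ.symm (φ y)) ∈ ψ.source := (hgU hy.1.2).2
    change b y = ψ.symm (g (φ y))
    rw [hg, Function.comp_apply, Function.comp_apply, ψ.left_inv hby, hinv]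
  refine ⟨⟨e.toPartialEquiv, e.open_source, e.open_target, hb.contMDiffOn.congr
    fun y hy => (heq hy).symm, ?_⟩, ⟨⟨hxs, hxg⟩, ?_⟩, heq⟩
  · exact contMDiffOn_chart_symm.comp (hgsymm.contMDiffOn.comp
      (contMDiffOn_chart.mono fun y hy => hy.1) fun y hy => hy.2.1) fun y hy => hy.2.2
  · change g (φ x) ∈ ψ.target
    rw [hg, Function.comp_apply, Function.comp_apply, hφx]
    exact mem_chart_target E (b x)

end InverseFunction

theorem exists_continuous_isCompact_le (M : Type*) [TopologicalSpace M] [T2Space M]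
    [LocallyCompactSpace M] [SigmaCompactSpace M] :
    ∃ ρ : C(M, ℝ), ∀ r : ℝ, IsCompact {x | ρ x ≤ r} := by
  obtain ⟨K⟩ : Nonempty (CompactExhaustion M) := inferInstance
  obtain ⟨ρ, hρ⟩ := exists_continuous_forall_mem_convex_of_local_const
    (t := fun x : M => Ici (K.find x : ℝ)) (fun x => convex_Ici _) (fun x => by
      refine ⟨(K.find x + 1 : ℕ), ?_⟩
      filter_upwards [mem_interior_iff_mem_nhds.1
        (K.subset_interior_succ _ (K.mem_find x))] with y hy
      exact Nat.cast_le (α := ℝ).2 (K.mem_iff_find_le.1 hy))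
  refine ⟨ρ, fun r => (K.isCompact ⌈r⌉₊).of_isClosed_subset
    (isClosed_le ρ.continuous continuous_const) fun x hx => ?_⟩
  rw [K.mem_iff_find_le]
  exact_mod_cast ((hρ x).trans hx).trans (Nat.le_ceil r)

section NearIdentity

variable {E : Type*} [NormedAddCommGroup E] [NormedSpace ℝ E]

theorem tendsto_clm_comp {F G : Type*} [NormedAddCommGroup F] [NormedSpace ℝ F]
    [NormedAddCommGroup G] [NormedSpace ℝ G] {Q : Type*} {l : Filter Q} {f : Q → F →L[ℝ] G}
    {g : Q → E →L[ℝ] F} {a : F →L[ℝ] G} {b : E →L[ℝ] F} (hf : Tendsto f l (𝓝 a))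
    (hg : Tendsto g l (𝓝 b)) : Tendsto (fun q => (f q).comp (g q)) l (𝓝 (a.comp b)) :=
  (isBoundedBilinearMap_comp.continuous.tendsto (a, b)).comp (hf.prodMk_nhds hg)

variable {M : Type*} [TopologicalSpace M] [ChartedSpace E M] [IsManifold 𝓘(ℝ, E) ∞ M]

theorem eventually_forall_of_locallyFinite {X Q κ : Type*} [TopologicalSpace X] {s : κ → Set X}
    (hs : LocallyFinite s) (hclosed : ∀ i, IsClosed (s i)) {l : Filter Q} {x : Q → X} {x₀ : X}
    (hx : Tendsto x l (𝓝 x₀)) {p : κ → Q → Prop} (hp : ∀ i, x₀ ∈ s i → ∀ᶠ q in l, p i q) :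
    ∀ᶠ q in l, ∀ i, x q ∈ s i → p i q := by
  filter_upwards [hx.eventually (hs.eventually_subset hclosed x₀),
    (eventually_all_finite (hs.point_finite x₀)).2 hp] with q hsub hq i hi using hq i (hsub hi)

theorem tendsto_tangentCoord_comp_tangentCoordSymm {c c' x₀ : M}
    (hc : x₀ ∈ (chartAt E c).source) (hc' : x₀ ∈ (chartAt E c').source) :
    Tendsto (fun x => (tangentCoord c x).comp (tangentCoordSymm c' x)) (𝓝 x₀)
      (𝓝 ((tangentCoord c x₀).comp (tangentCoordSymm (E := E) c' x₀))) := by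
  set e := trivializationAt E (TangentSpace 𝓘(ℝ, E)) c
  set e' := trivializationAt E (TangentSpace 𝓘(ℝ, E)) c'
  have hcont : ContinuousAt (fun x => (e'.coordChangeL ℝ e x : E →L[ℝ] E)) x₀ :=
    (continuousOn_coordChange ℝ e' e).continuousAt
      (((chartAt E c').open_source.inter (chartAt E c).open_source).mem_nhds ⟨hc', hc⟩)
  have heq : (fun x => (e'.coordChangeL ℝ e x : E →L[ℝ] E)) =ᶠ[𝓝 x₀]
      fun x => (tangentCoord c x).comp (tangentCoordSymm c' x) := by
    filter_upwards [(chartAt E c').open_source.mem_nhds hc',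
      (chartAt E c).open_source.mem_nhds hc] with x hx' hx
    ext v
    refine (e'.coordChangeL_apply e ⟨hx', hx⟩ v).trans ?_
    rw [← e'.symmL_apply (R := ℝ) (b := x) hx']
    exact (congrFun (e.coe_linearMapAt_of_mem (R := ℝ) hx) _).symm
  exact hcont.congr heq

theorem tendsto_inCoordinates_id_of_mem_source {Q : Type*} {l : Filter Q} {x y : Q → M}
    {L : Q → E →L[ℝ] E} {x₀ : M} (hx : Tendsto x l (𝓝 x₀)) (hy : Tendsto y l (𝓝 x₀))
    (hL : Tendsto (fun q => (tangentCoord x₀ (y q)).comp ((L q).comp (tangentCoordSymm x₀ (x q))))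
      l (𝓝 (.id ℝ E))) {c : M} (hc : x₀ ∈ (chartAt E c).source) :
    Tendsto (fun q => (tangentCoord c (y q)).comp ((L q).comp (tangentCoordSymm c (x q))))
      l (𝓝 (.id ℝ E)) := by
  have hx₀ : x₀ ∈ (chartAt E x₀).source := mem_chart_source E x₀
  have hlim := tendsto_clm_comp ((tendsto_tangentCoord_comp_tangentCoordSymm hc hx₀).comp hy)
    (tendsto_clm_comp hL ((tendsto_tangentCoord_comp_tangentCoordSymm hx₀ hc).comp hx))
  have hid : ((tangentCoord c x₀).comp (tangentCoordSymm x₀ x₀)).comp ((.id ℝ E : E →L[ℝ] E).comp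
      ((tangentCoord x₀ x₀).comp (tangentCoordSymm (E := E) c x₀))) = .id ℝ E := by
    rw [ContinuousLinearMap.id_comp, ContinuousLinearMap.comp_assoc,
      ← (tangentCoordSymm x₀ x₀).comp_assoc, tangentCoordSymm_comp_tangentCoord hx₀,
      ContinuousLinearMap.id_comp, tangentCoord_comp_tangentCoordSymm hc]
  rw [hid] at hlim
  refine hlim.congr' ?_
  filter_upwards [hx.eventually (chart_source_mem_nhds E x₀),
    hy.eventually (chart_source_mem_nhds E x₀)] with q hxq hyq
  have hxid := DFunLike.congr_fun (tangentCoordSymm_comp_tangentCoord (E := E) hxq)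
  have hyid := DFunLike.congr_fun (tangentCoordSymm_comp_tangentCoord (E := E) hyq)
  ext v
  exact congrArg (tangentCoord c (y q)) ((hyid _).trans (congrArg (L q) (hxid _)))

variable [FiniteDimensional ℝ E] {κ : Type*} {fs : SmoothBumpCovering κ 𝓘(ℝ, E) M} {ρ : M → ℝ}

/-- The pointwise condition saying that a map sending `x` to `y` with differential `L` is close to
the identity in the strong `C¹` topology. Closeness is measured in the charts of the bump
covering `fs`; the function `ρ`, taken to be proper, controls the behaviour at infinity. -/
structure IsNearIdentity (fs : SmoothBumpCovering κ 𝓘(ℝ, E) M) (ρ : M → ℝ) (x y : M)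
    (L : E →L[ℝ] E) : Prop where
  mem_support : ∀ i, fs i y = 1 → x ∈ Function.support (fs i)
  mem_source : ∀ i, x ∈ tsupport (fs i) → y ∈ (chartAt E (fs.c i)).source
  norm_sub_id_le : ∀ i, x ∈ tsupport (fs i) →
    ‖(tangentCoord (fs.c i) y).comp (L.comp (tangentCoordSymm (fs.c i) x)) - .id ℝ E‖ ≤ 1 / 2
  abs_sub_lt : |ρ y - ρ x| < 1
  mem_connectedComponent : y ∈ connectedComponent x

theorem eventually_isNearIdentity [T2Space M] (hρ : Continuous ρ) {Q : Type*} {l : Filter Q}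
    {x y : Q → M} {L : Q → E →L[ℝ] E} {x₀ : M} (hx : Tendsto x l (𝓝 x₀))
    (hy : Tendsto y l (𝓝 x₀))
    (hL : Tendsto (fun q => (tangentCoord x₀ (y q)).comp ((L q).comp (tangentCoordSymm x₀ (x q))))
      l (𝓝 (.id ℝ E))) :
    ∀ᶠ q in l, IsNearIdentity fs ρ (x q) (y q) (L q) := by
  have hsupp : ∀ i, {x | fs i x = 1} ⊆ Function.support (fs i) := fun i x hx => by
    rw [Function.mem_support, show fs i x = 1 from hx]; exact one_ne_zero
  have hsource : ∀ i, x₀ ∈ tsupport (fs i) → x₀ ∈ (chartAt E (fs.c i)).source :=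
    fun i hi => (fs i).tsupport_subset_chartAt_source hi
  have hρxy : Tendsto (fun q => |ρ (y q) - ρ (x q)|) l (𝓝 0) := by
    simpa using (((hρ.tendsto x₀).comp hy).sub ((hρ.tendsto x₀).comp hx)).abs
  have : LocallyConnectedSpace M := ChartedSpace.locallyConnectedSpace E M
  have hcomp : connectedComponent x₀ ∈ 𝓝 x₀ :=
    isOpen_connectedComponent.mem_nhds mem_connectedComponent
  have htsupp : LocallyFinite fun i => tsupport (fs i) := fs.locallyFinite.closure
  filter_upwards [
    eventually_forall_of_locallyFinite (fs.locallyFinite.subset hsupp)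
      (fun i => isClosed_eq (fs i).continuous continuous_const) hy
      fun i hi => hx.eventually ((fs i).isOpen_support.mem_nhds (hsupp i hi)),
    eventually_forall_of_locallyFinite htsupp (fun i => isClosed_tsupport _) hx
      fun i hi => hy.eventually ((chartAt E (fs.c i)).open_source.mem_nhds (hsource i hi)),
    eventually_forall_of_locallyFinite htsupp (fun i => isClosed_tsupport _) hx
      fun i hi => (tendsto_inCoordinates_id_of_mem_source hx hy hL (hsource i hi)).eventually
        (Metric.closedBall_mem_nhds _ one_half_pos),
    hρxy.eventually (gt_mem_nhds one_pos), hy.eventually hcomp, hx.eventually hcomp]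
    with q hone hsrc hnorm hlt hyc hxc
  exact ⟨hone, hsrc, fun i hi => by simpa only [dist_eq_norm] using hnorm i hi, hlt,
    connectedComponent_eq hxc ▸ hyc⟩

end NearIdentity

section NearIdentityMaps

variable {E : Type*} [NormedAddCommGroup E] [NormedSpace ℝ E] [FiniteDimensional ℝ E]
  {M : Type*} [TopologicalSpace M] [ChartedSpace E M]
  {κ : Type*} {fs : SmoothBumpCovering κ 𝓘(ℝ, E) M} {ρ : M → ℝ}

theorem exists_bump_eq_one (fs : SmoothBumpCovering κ 𝓘(ℝ, E) M) (x : M) : ∃ i, fs i x = 1 :=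
  (fs.eventuallyEq_one' x (mem_univ x)).imp fun _ hi => hi.eq_of_nhds

variable [IsManifold 𝓘(ℝ, E) ∞ M] [T2Space M]

theorem IsNearIdentity.isInvertible {x y : M} {L : E →L[ℝ] E} (h : IsNearIdentity fs ρ x y L) :
    L.IsInvertible := by
  obtain ⟨i, hi⟩ := exists_bump_eq_one fs x
  have hxi : x ∈ tsupport (fs i) := subset_tsupport _ (by simp [hi])
  have hinj : Function.Injective L := by
    refine (injective_iff_map_eq_zero L).2 fun v hv => ?_
    have hid := tangentCoordSymm_comp_tangentCoord (E := E)
      ((fs i).tsupport_subset_chartAt_source hxi)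
    set w := tangentCoord (fs.c i) x v
    have hsymm : tangentCoordSymm (fs.c i) x w = v := DFunLike.congr_fun hid v
    have hle := ContinuousLinearMap.le_of_opNorm_le _ (h.norm_sub_id_le i hxi) w
    have hw : w = 0 := by
      simp only [sub_apply, ContinuousLinearMap.comp_apply, hsymm, hv, map_zero,
        ContinuousLinearMap.id_apply, zero_sub, norm_neg] at hle
      exact norm_le_zero_iff.1 (by linarith)
    rw [← hsymm, hw, map_zero]
  exact ⟨(LinearEquiv.ofInjectiveEndo (L : E →ₗ[ℝ] E) hinj).toContinuousLinearEquiv, rfl⟩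

variable {b : M → M}

theorem hasFDerivAt_inChart_of_isNearIdentity (hb : MDifferentiable 𝓘(ℝ, E) 𝓘(ℝ, E) b)
    (hnear : ∀ x, IsNearIdentity fs ρ x (b x) (modelDeriv E E b x)) {i : κ} {x : M}
    (hx : x ∈ tsupport (fs i)) :
    HasFDerivAt (extChartAt 𝓘(ℝ, E) (fs.c i) ∘ b ∘ (extChartAt 𝓘(ℝ, E) (fs.c i)).symm)
      ((tangentCoord (fs.c i) (b x)).comp
        ((modelDeriv E E b x).comp (tangentCoordSymm (fs.c i) x)))
      (extChartAt 𝓘(ℝ, E) (fs.c i) x) := by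
  have hbx := (hnear x).mem_source i hx
  have hφ := mdifferentiableAt_extChartAt (I := 𝓘(ℝ, E)) hbx
  have hderiv := hasFDerivAt_comp_extChartAt_symm (hφ.comp x (hb x))
    ((fs i).tsupport_subset_chartAt_source hx)
  rwa [modelDeriv_comp hφ (hb x), ← tangentCoord_eq_modelDeriv hbx] at hderiv

theorem injective_of_isNearIdentity (hb : MDifferentiable 𝓘(ℝ, E) 𝓘(ℝ, E) b)
    (hnear : ∀ x, IsNearIdentity fs ρ x (b x) (modelDeriv E E b x)) : Function.Injective b := by
  intro x x' hxx'
  obtain ⟨i, hi⟩ := exists_bump_eq_one fs (b x)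
  have hx : x ∈ Function.support (fs i) := (hnear x).mem_support i hi
  have hx' : x' ∈ Function.support (fs i) := (hnear x').mem_support i (hxx' ▸ hi)
  set φ := extChartAt 𝓘(ℝ, E) (fs.c i)
  set B := Metric.ball (φ (fs.c i)) (fs i).rOut
  have hsupport : Function.support (fs i) = φ.source ∩ φ ⁻¹' B := by
    rw [(fs i).support_eq_inter_preimage, ← extChartAt_source 𝓘(ℝ, E)]
  have hbound : ∀ w ∈ B, ∃ D : E →L[ℝ] E,
      HasFDerivAt (fun w => (φ ∘ b ∘ φ.symm) w - w) D w ∧ ‖D‖ ≤ 1 / 2 := by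
    intro w hw
    have hwt : w ∈ φ.target := (fs i).ball_subset ⟨hw, by simp⟩
    have hmem : φ.symm w ∈ tsupport (fs i) := by
      refine subset_tsupport _ (hsupport ▸ ⟨φ.map_target hwt, ?_⟩)
      rwa [mem_preimage, φ.right_inv hwt]
    have hderiv := hasFDerivAt_inChart_of_isNearIdentity hb hnear hmem
    rw [φ.right_inv hwt] at hderiv
    exact ⟨_, hderiv.sub (hasFDerivAt_id w), (hnear _).norm_sub_id_le i hmem⟩
  choose! D hD hDle using hbound
  rw [hsupport] at hx hx'
  have hle := (convex_ball _ _).norm_image_sub_le_of_norm_hasFDerivWithin_le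
    (fun w hw => (hD w hw).hasFDerivWithinAt) hDle hx.2 hx'.2
  simp only [Function.comp_apply, φ.left_inv hx.1, φ.left_inv hx'.1, hxx', sub_sub_sub_cancel_left,
    norm_sub_rev (φ x)] at hle
  exact φ.injOn hx.1 hx'.1 (sub_eq_zero.1 (norm_le_zero_iff.1
    (by linarith [norm_nonneg (φ x' - φ x), norm_sub_rev (φ x) (φ x')])))

theorem exists_diffeomorph_of_isNearIdentity (hρ : ∀ r, IsCompact {x | ρ x ≤ r})
    (hρc : Continuous ρ) (hb : ContMDiff 𝓘(ℝ, E) 𝓘(ℝ, E) ∞ b)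
    (hnear : ∀ x, IsNearIdentity fs ρ x (b x) (modelDeriv E E b x)) :
    ∃ e : M ≃ₘ⟮𝓘(ℝ, E), 𝓘(ℝ, E)⟯ M, ⇑e = b := by
  have : LocallyCompactSpace M := ChartedSpace.locallyCompactSpace E M
  have hlocal : IsLocalDiffeomorph 𝓘(ℝ, E) 𝓘(ℝ, E) ∞ b := fun x =>
    isLocalDiffeomorphAt_of_isInvertible_modelDeriv hb (hnear x).isInvertible
  have hproper : IsProperMap b := by
    refine isProperMap_iff_isCompact_preimage.2 ⟨hb.continuous, fun K hK => ?_⟩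
    obtain ⟨r, hr⟩ := hK.bddAbove_image hρc.continuousOn
    refine (hρ (r + 1)).of_isClosed_subset (hK.isClosed.preimage hb.continuous) fun x hx => ?_
    have hbx : ρ (b x) ≤ r := hr (mem_image_of_mem ρ hx)
    have hlt := (abs_lt.1 (hnear x).abs_sub_lt).1
    change ρ x ≤ r + 1
    linarith
  have hclopen : IsClopen (range b) := ⟨hproper.isClosedMap.isClosed_range, hlocal.isOpen_range⟩
  have hsurj : Function.Surjective b := fun x =>
    hclopen.connectedComponent_subset (mem_range_self x)
      (connectedComponent_eq (hnear x).mem_connectedComponent ▸ mem_connectedComponent)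
  exact ⟨hlocal.diffeomorphOfBijective
    ⟨injective_of_isNearIdentity (hb.mdifferentiable (by simp)) hnear, hsurj⟩, rfl⟩

end NearIdentityMaps

section JetNeighbourhoods

variable {E : Type*} [NormedAddCommGroup E] [NormedSpace ℝ E]
  {M : Type*} [TopologicalSpace M] [ChartedSpace E M]
  {F : Type*} [NormedAddCommGroup F] [NormedSpace ℝ F]
  {S : Type*} [TopologicalSpace S] [ChartedSpace F S]
  [IsManifold 𝓘(ℝ, E) ∞ M] [IsManifold 𝓘(ℝ, F) ∞ S]
  {σ : M → S} {I J : Set ℝ} {ε₀ : ℝ} {x₀ : M}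

/-- The neighbourhood filter of `σ` in the strong (Whitney) `C¹` topology on maps `M → S`. -/
def whitneyNhds (E : Type*) [NormedAddCommGroup E] [NormedSpace ℝ E]
    (F : Type*) [NormedAddCommGroup F] [NormedSpace ℝ F]
    {M : Type*} [TopologicalSpace M] [ChartedSpace E M]
    {S : Type*} [TopologicalSpace S] [ChartedSpace F S]
    [IsManifold 𝓘(ℝ, E) ∞ M] [IsManifold 𝓘(ℝ, F) ∞ S] (σ : M → S) : Filter (M → S) where
  sets := {U | ∃ W : Set (OneJets E M F S), IsOpen W ∧ JetsIn W σ ∧ ∀ ι, JetsIn W ι → ι ∈ U}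
  univ_sets := ⟨univ, isOpen_univ, fun _ => mem_univ _, fun _ _ => mem_univ _⟩
  sets_of_superset := fun ⟨W, hWo, hσW, hW⟩ hUV => ⟨W, hWo, hσW, fun ι hι => hUV (hW ι hι)⟩
  inter_sets := fun ⟨W, hWo, hσW, hW⟩ ⟨W', hWo', hσW', hW'⟩ =>
    ⟨W ∩ W', hWo.inter hWo', fun x => ⟨hσW x, hσW' x⟩,
      fun ι hι => ⟨hW ι fun x => (hι x).1, hW' ι fun x => (hι x).2⟩⟩

theorem eventually_whitneyNhds {p : (M → S) → Prop} : (∀ᶠ ι in whitneyNhds E F σ, p ι) ↔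
    ∃ W : Set (OneJets E M F S), IsOpen W ∧ JetsIn W σ ∧ ∀ ι, JetsIn W ι → p ι := Iff.rfl

theorem eventually_whitneyNhds_of_oneJet (hJ : IsCompact J) (hJI : J ⊆ I)
    {p : OneJets E M F S → ℝ → Prop}
    (hp : ∀ x, ∀ ε₀ ∈ J, ∀ᶠ q in 𝓝 (oneJet σ x) ×ˢ 𝓝[I] ε₀, p q.1 q.2) :
    ∀ᶠ ι in whitneyNhds E F σ, ∀ x, ∀ ε ∈ J, p (oneJet ι x) ε := by
  refine ⟨interior {j | ∀ ε ∈ J, p j ε}, isOpen_interior, fun x => ?_,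
    fun ι hι x => interior_subset (hι x)⟩
  have hev : ∀ᶠ j in 𝓝 (oneJet σ x), ∀ ε ∈ J, ε ∈ I → p j ε := by
    refine hJ.eventually_forall_of_forall_eventually fun ε₀ hε₀ => ?_
    have h := hp x ε₀ hε₀
    rw [← nhdsWithin_univ, ← nhdsWithin_prod_eq, eventually_nhdsWithin_iff] at h
    exact h.mono fun q hq hqI => hq ⟨mem_univ _, hqI⟩
  exact mem_interior_iff_mem_nhds.2 (hev.mono fun j hj ε hε => hj ε hε (hJI hε))

theorem tendsto_inCoordinates_comp_jetMap {γ : ℝ → S → M} (hγ : IsSmoothFamily F E I γ)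
    (hε₀ : ε₀ ∈ I) (j₀ : OneJets E M F S) :
    Tendsto (fun q : OneJets E M F S × ℝ =>
      (tangentCoord (γ ε₀ j₀.proj.2) (γ q.2 q.1.proj.2)).comp
        (((modelDeriv F E (γ q.2) q.1.proj.2).comp (jetMap q.1)).comp
          (tangentCoordSymm j₀.proj.1 q.1.proj.1)))
      (𝓝 j₀ ×ˢ 𝓝[I] ε₀)
      (𝓝 ((tangentCoord (γ ε₀ j₀.proj.2) (γ ε₀ j₀.proj.2)).comp
        (((modelDeriv F E (γ ε₀) j₀.proj.2).comp (jetMap j₀)).comp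
          (tangentCoordSymm j₀.proj.1 j₀.proj.1)))) := by
  have hproj : Tendsto (fun q : OneJets E M F S × ℝ => (q.1.proj.2, q.2))
      (𝓝 j₀ ×ˢ 𝓝[I] ε₀) (𝓝 j₀.proj.2 ×ˢ 𝓝[I] ε₀) :=
    (continuous_proj_oneJets.tendsto j₀).snd_nhds.prodMap tendsto_id
  have hlim := tendsto_clm_comp ((hγ.tendsto_modelDeriv hε₀ j₀.proj.2).comp hproj)
    ((continuousAt_jetMap_inCoordinates j₀).tendsto.comp tendsto_fst)
  have hcancel : ∀ {z : S}, z ∈ (chartAt F j₀.proj.2).source →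
      ∀ (A : E →L[ℝ] E) (D : F →L[ℝ] E) (T : E →L[ℝ] F) (B : E →L[ℝ] E),
        (A.comp (D.comp (tangentCoordSymm j₀.proj.2 z))).comp
            ((tangentCoord j₀.proj.2 z).comp (T.comp B)) =
          A.comp ((D.comp T).comp B) := by
    intro z hz A D T B
    ext v
    exact congrArg (fun w => A (D w))
      (DFunLike.congr_fun (tangentCoordSymm_comp_tangentCoord hz) (T (B v)))
  rw [hcancel (mem_chart_source F _)] at hlim
  refine hlim.congr' ?_
  filter_upwards [((continuous_proj_oneJets.tendsto j₀).snd_nhds.comp tendsto_fst).eventually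
    (chart_source_mem_nhds F j₀.proj.2)] with q hq
  exact hcancel hq _ _ _ _

theorem eventually_isNearIdentity_of_section [FiniteDimensional ℝ E] [T2Space M] {κ : Type*}
    {fs : SmoothBumpCovering κ 𝓘(ℝ, E) M} {ρ : M → ℝ} (hρ : Continuous ρ)
    {γ : ℝ → S → M} (hγ : IsSmoothFamily F E I γ) (hε₀ : ε₀ ∈ I)
    (hσ : MDifferentiable 𝓘(ℝ, E) 𝓘(ℝ, F) σ) (hγσ : ∀ x, γ ε₀ (σ x) = x) (x₀ : M) :
    ∀ᶠ q in 𝓝 (oneJet σ x₀) ×ˢ 𝓝[I] ε₀, IsNearIdentity fs ρ q.1.proj.1 (γ q.2 q.1.proj.2)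
      ((modelDeriv F E (γ q.2) q.1.proj.2).comp (jetMap q.1)) := by
  have hproj := continuous_proj_oneJets.tendsto (oneJet σ x₀ : OneJets E M F S)
  have hbase := (hγ.tendsto hε₀ (σ x₀)).comp
    (hproj.snd_nhds.prodMap (tendsto_id (x := 𝓝[I] ε₀)))
  have hlin := tendsto_inCoordinates_comp_jetMap hγ hε₀ (oneJet σ x₀)
  have hid : (modelDeriv F E (γ ε₀) (σ x₀)).comp (modelDeriv E F σ x₀) = .id ℝ E := by
    rw [← modelDeriv_comp (hγ.mdifferentiableAt hε₀ _) (hσ x₀),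
      show γ ε₀ ∘ σ = id from funext hγσ, modelDeriv_id]
  simp only [proj_oneJet, jetMap_oneJet, hid, hγσ, ContinuousLinearMap.id_comp,
    tangentCoord_comp_tangentCoordSymm (mem_chart_source E x₀)] at hbase hlin
  exact eventually_isNearIdentity hρ (hproj.fst_nhds.comp tendsto_fst) hbase hlin

/-- A family of diffeomorphisms of `M`, with parameters in `J`, under which the preimages of a
compact set lie in one compact set; for compact `J` this is properness of `(b_ε(y), ε)` as a map
of `(y, ε) ∈ M × J`. -/
structure IsProperDiffeoFamily (E : Type*) [NormedAddCommGroup E] [NormedSpace ℝ E] {M : Type*}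
    [TopologicalSpace M] [ChartedSpace E M] (J : Set ℝ) (b : ℝ → M → M) : Prop where
  exists_diffeomorph : ∀ ε ∈ J, ∃ e : M ≃ₘ⟮𝓘(ℝ, E), 𝓘(ℝ, E)⟯ M, ⇑e = b ε
  exists_isCompact : ∀ K : Set M, IsCompact K →
    ∃ K' : Set M, IsCompact K' ∧ ∀ ε ∈ J, ∀ y, b ε y ∈ K → y ∈ K'

theorem IsSmoothFamily.eventually_isProperDiffeoFamily [FiniteDimensional ℝ E] [T2Space M]
    [SigmaCompactSpace M] {γ : ℝ → S → M} (hγ : IsSmoothFamily F E I γ) (hJ : IsCompact J)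
    (hJI : J ⊆ I) (hσ : MDifferentiable 𝓘(ℝ, E) 𝓘(ℝ, F) σ) (hγσ : ∀ ε ∈ J, ∀ x, γ ε (σ x) = x) :
    ∀ᶠ ι in whitneyNhds E F σ, ContMDiff 𝓘(ℝ, E) 𝓘(ℝ, F) ∞ ι →
      IsProperDiffeoFamily E J fun ε => γ ε ∘ ι := by
  have : LocallyCompactSpace M := ChartedSpace.locallyCompactSpace E M
  obtain ⟨ρ, hρ⟩ := exists_continuous_isCompact_le M
  obtain ⟨κ, fs, -⟩ := SmoothBumpCovering.exists_isSubordinate 𝓘(ℝ, E) (isClosed_univ (X := M))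
    (U := fun _ => univ) fun x _ => univ_mem
  filter_upwards [eventually_whitneyNhds_of_oneJet (σ := σ)
    (p := fun j ε => IsNearIdentity fs ρ j.proj.1 (γ ε j.proj.2)
      ((modelDeriv F E (γ ε) j.proj.2).comp (jetMap j))) hJ hJI fun x ε₀ hε₀ =>
    eventually_isNearIdentity_of_section ρ.continuous hγ (hJI hε₀) hσ (hγσ ε₀ hε₀) x]
    with ι hnearι hι
  have hnear : ∀ ε ∈ J, ∀ x,
      IsNearIdentity fs ρ x ((γ ε ∘ ι) x) (modelDeriv E E (γ ε ∘ ι) x) := by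
    intro ε hε x
    rw [modelDeriv_comp (hγ.mdifferentiableAt (hJI hε) _) (hι.mdifferentiableAt (by simp))]
    exact hnearι x ε hε
  refine ⟨fun ε hε => exists_diffeomorph_of_isNearIdentity hρ ρ.continuous
    ((hγ.contMDiff (hJI hε)).comp hι) (hnear ε hε), fun K hK => ?_⟩
  obtain ⟨r, hr⟩ := hK.bddAbove_image ρ.continuous.continuousOn
  refine ⟨_, hρ (r + 1), fun ε hε x hx => ?_⟩
  have hle : ρ ((γ ε ∘ ι) x) ≤ r := hr (mem_image_of_mem ρ hx)
  have hlt := (abs_lt.1 (hnear ε hε x).abs_sub_lt).1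
  exact (show ρ x ≤ r + 1 by linarith)

end JetNeighbourhoods

section Fibres

variable {E F G : Type*} [NormedAddCommGroup E] [NormedSpace ℝ E] [NormedAddCommGroup F]
  [NormedSpace ℝ F] [NormedAddCommGroup G] [NormedSpace ℝ G]

theorem eq_of_fst_eq_of_fderiv_eq_zero {k : OpenPartialHomeomorph F (E × G)} {s : Set (E × G)}
    (hs : Convex ℝ s) (hst : s ⊆ k.target)
    (hk : ∀ w ∈ k.source, ∃ L : F ≃L[ℝ] E × G, HasFDerivAt k (L : F →L[ℝ] E × G) w)
    {u : F → ℝ} (hu : ∀ w ∈ k.source, DifferentiableAt ℝ u w)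
    (hker : ∀ w ∈ k.source, ∀ v, (fderiv ℝ k w v).1 = 0 → fderiv ℝ u w v = 0) {w w' : F}
    (hw : w ∈ k.source) (hw' : w' ∈ k.source) (hkw : k w ∈ s) (hkw' : k w' ∈ s)
    (h : (k w).1 = (k w').1) : u w = u w' := by
  set γ : ℝ → E × G := fun t => k w + t • (k w' - k w)
  have hγ : ∀ t ∈ Icc (0 : ℝ) 1, γ t ∈ s := fun t ht => hs.add_smul_sub_mem hkw hkw' ht
  have hderiv : ∀ t ∈ Icc (0 : ℝ) 1, HasDerivWithinAt (u ∘ k.symm ∘ γ) 0 (Icc 0 1) t := by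
    intro t ht
    have hsource := k.map_target (hst (hγ t ht))
    obtain ⟨L, hL⟩ := hk _ hsource
    have hγt : HasDerivAt γ (k w' - k w) t := by
      simpa only [one_smul] using! ((hasDerivAt_id t).smul_const (k w' - k w)).const_add (k w)
    have hcomp := ((hu _ hsource).hasFDerivAt.comp _
      (k.hasFDerivAt_symm (hst (hγ t ht)) hL)).comp_hasDerivAt t hγt
    have hzero : fderiv ℝ u (k.symm (γ t)) (L.symm (k w' - k w)) = 0 := by
      refine hker _ hsource _ ?_
      rw [hL.fderiv]
      simp [h]
    exact (hcomp.congr_deriv hzero).hasDerivWithinAt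
  have hle := (convex_Icc (0 : ℝ) 1).norm_image_sub_le_of_norm_hasDerivWithin_le (C := 0) hderiv
    (by simp) (left_mem_Icc.2 zero_le_one) (right_mem_Icc.2 zero_le_one)
  simp only [γ, Function.comp_apply, one_smul, zero_smul, add_zero, add_sub_cancel, zero_mul,
    k.left_inv hw, k.left_inv hw'] at hle
  exact (sub_eq_zero.1 (norm_le_zero_iff.1 hle)).symm

variable {Q : Type*} {l : Filter Q} {w₀ : F} {O : Set F}

theorem exists_uniform_openPartialHomeomorph [CompleteSpace F] [Nontrivial F] {g : Q → F → G}
    {L : F ≃L[ℝ] G} {y₀ : G} (hO : O ∈ 𝓝 w₀)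
    (hderiv : Tendsto (fun p : F × Q => fderiv ℝ (g p.2) p.1) (𝓝 w₀ ×ˢ l) (𝓝 (L : F →L[ℝ] G)))
    (hdiff : ∀ᶠ p in 𝓝 w₀ ×ˢ l, DifferentiableAt ℝ (g p.2) p.1)
    (hg : Tendsto (fun p : F × Q => g p.2 p.1) (𝓝 w₀ ×ˢ l) (𝓝 y₀)) :
    ∃ N ∈ 𝓝 w₀, ∃ s : Set G, Convex ℝ s ∧ ∀ᶠ q in l, ∃ k : OpenPartialHomeomorph F G,
      ⇑k = g q ∧ N ⊆ k.source ∧ k.source ⊆ O ∧ s ⊆ k.target ∧ MapsTo k N s ∧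
      ∀ w ∈ k.source, ∃ L' : F ≃L[ℝ] G, HasFDerivAt k (L' : F →L[ℝ] G) w := by
  set m := ‖(L.symm : G →L[ℝ] F)‖₊
  have hm : 0 < m := L.norm_symm_pos
  have hc : m⁻¹ / 2 < m⁻¹ := NNReal.half_lt_self (inv_pos.2 hm).ne'
  have hball := Metric.closedBall_mem_nhds (L : F →L[ℝ] G)
    (NNReal.coe_pos.2 (half_pos (inv_pos.2 hm)))
  obtain ⟨a, ha, b, hb, hab⟩ := eventually_prod_iff.1
    (((hderiv.eventually hball).and (hderiv.eventually L.nhds)).and hdiff)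
  obtain ⟨δ, hδ, hδa⟩ := Metric.mem_nhds_iff.1 (inter_mem ha hO)
  set r : ℝ := ((m : ℝ)⁻¹ - (m⁻¹ / 2 : NNReal)) * (δ / 2)
  have hr : 0 < r := mul_pos (sub_pos.2 (by exact_mod_cast hc)) (half_pos hδ)
  obtain ⟨a', ha', b', hb', hab'⟩ := eventually_prod_iff.1
    (hg.eventually (Metric.ball_mem_nhds y₀ (half_pos hr)))
  refine ⟨{w | a' w} ∩ Metric.ball w₀ δ, inter_mem ha' (Metric.ball_mem_nhds _ hδ),
    Metric.ball y₀ (r / 2), convex_ball _ _, ?_⟩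
  filter_upwards [hb, hb'] with q hq hq'
  have hgood : ∀ w ∈ Metric.ball w₀ δ, DifferentiableAt ℝ (g q) w := fun w hw =>
    (hab (hδa hw).1 hq).2
  have happrox : ApproximatesLinearOn (g q) (L : F →L[ℝ] G) (Metric.ball w₀ δ) (m⁻¹ / 2) :=
    fun w hw w' hw' => (convex_ball w₀ δ).norm_image_sub_le_of_norm_hasFDerivWithin_le'
      (fun x hx => (hgood x hx).hasFDerivAt.hasFDerivWithinAt)
      (fun x hx => by simpa only [dist_eq_norm] using! (hab (hδa hx).1 hq).1.1) hw' hw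
  set k := happrox.toOpenPartialHomeomorph (g q) _ (Or.inr hc) Metric.isOpen_ball
  refine ⟨k, rfl, inter_subset_right, fun w hw => (hδa hw).2, ?_,
    fun w hw => hab' hw.1 hq', fun w hw => ?_⟩
  · have htarget : Metric.closedBall (g q w₀) r ⊆ k.target :=
      happrox.closedBall_subset_target (Or.inr hc) Metric.isOpen_ball
        (half_pos hδ).le (Metric.closedBall_subset_ball (half_lt_self hδ))
    have hcentre : dist y₀ (g q w₀) < r / 2 := by
      rw [dist_comm]; exact hab' (mem_of_mem_nhds ha') hq'
    exact fun y hy => htarget (Metric.mem_closedBall.2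
      ((dist_triangle y y₀ _).trans (by linarith [Metric.mem_ball.1 hy])))
  · obtain ⟨L', hL'⟩ := (hab (hδa hw).1 hq).1.2
    exact ⟨L', hL' ▸ (hgood w hw).hasFDerivAt⟩

theorem exists_nhds_eq_of_fibre_eq_of_tendsto_fderiv [FiniteDimensional ℝ F] [CompleteSpace E]
    {B : Q → F → E}
    {T : F →L[ℝ] E} {e₀ : E} (hT : Function.Surjective T) (hO : O ∈ 𝓝 w₀)
    (hderiv : Tendsto (fun p : F × Q => fderiv ℝ (B p.2) p.1) (𝓝 w₀ ×ˢ l) (𝓝 T))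
    (hdiff : ∀ᶠ p in 𝓝 w₀ ×ˢ l, DifferentiableAt ℝ (B p.2) p.1)
    (hB : Tendsto (fun p : F × Q => B p.2 p.1) (𝓝 w₀ ×ˢ l) (𝓝 e₀)) :
    ∃ N ∈ 𝓝 w₀, ∀ᶠ q in l, ∀ w ∈ N, ∀ w' ∈ N, B q w = B q w' → ∀ u : F → ℝ,
      (∀ y ∈ O, DifferentiableAt ℝ u y) →
      (∀ y ∈ O, ∀ v, fderiv ℝ (B q) y v = 0 → fderiv ℝ u y v = 0) → u w = u w' := by
  rcases subsingleton_or_nontrivial F with hF | hF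
  · exact ⟨univ, univ_mem, .of_forall fun q w _ w' _ _ u _ _ => by rw [Subsingleton.elim w w']⟩
  obtain ⟨R, hR⟩ := Submodule.ClosedComplemented.of_finiteDimensional T.ker
  set L := T.equivProdOfSurjectiveOfIsCompl R (LinearMap.range_eq_top.2 hT)
    (LinearMap.range_eq_of_proj hR) (LinearMap.isCompl_of_proj hR)
  have hcoord : ∀ᶠ p in 𝓝 w₀ ×ˢ l, HasFDerivAt (fun w => (B p.2 w, R w))
      ((fderiv ℝ (B p.2) p.1).prod R) p.1 :=
    hdiff.mono fun p hp => hp.hasFDerivAt.prodMk R.hasFDerivAt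
  have hlim : Tendsto (fun p : F × Q => (fderiv ℝ (B p.2) p.1).prod R) (𝓝 w₀ ×ˢ l)
      (𝓝 (L : F →L[ℝ] E × T.ker)) :=
    ((ContinuousLinearMap.prodₗᵢ ℝ).continuous.tendsto (T, R)).comp
      (hderiv.prodMk_nhds tendsto_const_nhds)
  obtain ⟨a, ha, b, hb, hab⟩ := eventually_prod_iff.1 hcoord
  obtain ⟨N, hN, s, hs, hk⟩ := exists_uniform_openPartialHomeomorph
    (g := fun q w => (B q w, R w)) (y₀ := (e₀, R w₀)) (inter_mem ha hO)
    (hlim.congr' (hcoord.mono fun p hp => hp.fderiv.symm))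
    (hcoord.mono fun p hp => hp.differentiableAt)
    (hB.prodMk_nhds ((R.continuous.tendsto w₀).comp tendsto_fst))
  refine ⟨N, hN, ?_⟩
  filter_upwards [hk, hb] with q ⟨k, hkq, hNk, hkO, hst, hmaps, hk'⟩ hq w hw w' hw' hww' u hu hker
  refine eq_of_fst_eq_of_fderiv_eq_zero hs hst hk' (fun y hy => hu y (hkO hy).2)
    (fun y hy v hv => hker y (hkO hy).2 v ?_) (hNk hw) (hNk hw') (hmaps hw) (hmaps hw')
    (by simpa only [hkq] using hww')
  rw [hkq, (hab (hkO hy).1 hq).fderiv] at hv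
  exact hv

theorem IsSmoothFamily.tendsto_fderiv_inChart {S : Type*} [TopologicalSpace S] [ChartedSpace F S]
    [IsManifold 𝓘(ℝ, F) ∞ S] {I : Set ℝ} {ε₀ : ℝ} {h : ℝ → S → G} (hh : IsSmoothFamily F G I h)
    (hε₀ : ε₀ ∈ I) (z₀ : S) :
    Tendsto (fun p : F × ℝ => fderiv ℝ (h p.2 ∘ (extChartAt 𝓘(ℝ, F) z₀).symm) p.1)
      (𝓝 (extChartAt 𝓘(ℝ, F) z₀ z₀) ×ˢ 𝓝[I] ε₀)
      (𝓝 ((modelDeriv F G (h ε₀) z₀).comp (tangentCoordSymm z₀ z₀))) := by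
  set θ := extChartAt 𝓘(ℝ, F) z₀
  have hsymm : Tendsto θ.symm (𝓝 (θ z₀)) (𝓝 z₀) := by
    simpa only [ContinuousAt, θ, extChartAt_to_inv] using continuousAt_extChartAt_symm z₀
  refine ((hh.tendsto_modelDeriv_vector hε₀ z₀).comp
    (hsymm.prodMap (tendsto_id (x := 𝓝[I] ε₀)))).congr' ?_
  filter_upwards [prod_mem_prod (extChartAt_target_mem_nhds z₀) self_mem_nhdsWithin] with p hp
  exact (hasFDerivAt_comp_extChartAt_symm_of_mem_target hp.1
    (hh.mdifferentiableAt hp.2 _)).fderiv.symm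

end Fibres

section FamilyFibres

variable {E F : Type*} [NormedAddCommGroup E] [NormedSpace ℝ E]
  [NormedAddCommGroup F] [NormedSpace ℝ F] [FiniteDimensional ℝ F]
  {M : Type*} [TopologicalSpace M] [ChartedSpace E M]
  {S : Type*} [TopologicalSpace S] [ChartedSpace F S] [IsManifold 𝓘(ℝ, F) ∞ S]
  {I J : Set ℝ} {ε₀ : ℝ}

theorem IsSmoothFamily.exists_nhds_eq_of_fibre_eq_vector [CompleteSpace E] {h : ℝ → S → E}
    (hh : IsSmoothFamily F E I h) (hε₀ : ε₀ ∈ I) {z₀ : S}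
    (hsurj : Function.Surjective (modelDeriv F E (h ε₀) z₀)) {U : Set S} (hU : U ∈ 𝓝 z₀) :
    ∃ N ∈ 𝓝 z₀, ∀ᶠ ε in 𝓝[I] ε₀, ∀ z ∈ N, ∀ z' ∈ N, h ε z = h ε z' →
      ∀ u : S → ℝ, MDifferentiable 𝓘(ℝ, F) 𝓘(ℝ, ℝ) u →
        (∀ y ∈ U, ∀ v, modelDeriv F E (h ε) y v = 0 → modelDeriv F ℝ u y v = 0) → u z = u z' := by
  set θ := extChartAt 𝓘(ℝ, F) z₀
  have hsymm : Tendsto θ.symm (𝓝 (θ z₀)) (𝓝 z₀) := by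
    simpa only [ContinuousAt, θ, extChartAt_to_inv] using continuousAt_extChartAt_symm z₀
  have hdiff : ∀ w ∈ θ.target, ∀ ε ∈ I, HasFDerivAt (h ε ∘ θ.symm)
      ((modelDeriv F E (h ε) (θ.symm w)).comp (tangentCoordSymm z₀ (θ.symm w))) w :=
    fun w hw ε hε => hasFDerivAt_comp_extChartAt_symm_of_mem_target hw (hh.mdifferentiableAt hε _)
  obtain ⟨N, hN, hfib⟩ := exists_nhds_eq_of_fibre_eq_of_tendsto_fderiv
    (B := fun ε => h ε ∘ θ.symm) (T := (modelDeriv F E (h ε₀) z₀).comp (tangentCoordSymm z₀ z₀))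
    (hsurj.comp (isInvertible_tangentCoordSymm (mem_chart_source F z₀)).surjective)
    (inter_mem (hsymm hU) (extChartAt_target_mem_nhds z₀))
    (hh.tendsto_fderiv_inChart hε₀ z₀)
    (mem_of_superset (prod_mem_prod (extChartAt_target_mem_nhds z₀) self_mem_nhdsWithin)
      fun p hp => (hdiff p.1 hp.1 p.2 hp.2).differentiableAt)
    ((hh.tendsto hε₀ z₀).comp (hsymm.prodMap tendsto_id))
  refine ⟨θ ⁻¹' N ∩ θ.source, inter_mem ((continuousAt_extChartAt z₀).preimage_mem_nhds hN)
    (extChartAt_source_mem_nhds z₀), ?_⟩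
  filter_upwards [hfib, self_mem_nhdsWithin] with ε hfib hεI z hz z' hz' hzz' u hu hker
  have hu' : ∀ w ∈ θ.target, HasFDerivAt (u ∘ θ.symm)
      ((modelDeriv F ℝ u (θ.symm w)).comp (tangentCoordSymm z₀ (θ.symm w))) w := fun w hw =>
    hasFDerivAt_comp_extChartAt_symm_of_mem_target hw (hu _)
  have huz := hfib (θ z) hz.1 (θ z') hz'.1
    (by simp only [Function.comp_apply, θ.left_inv hz.2, θ.left_inv hz'.2, hzz']) (u ∘ θ.symm)
    (fun w hw => (hu' w hw.2).differentiableAt) fun w hw v hv => ?_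
  · simpa only [Function.comp_apply, θ.left_inv hz.2, θ.left_inv hz'.2] using huz
  rw [(hdiff w hw.2 ε hεI).fderiv] at hv
  rw [(hu' w hw.2).fderiv]
  exact hker _ hw.1 _ hv

variable [FiniteDimensional ℝ E] [IsManifold 𝓘(ℝ, E) ∞ M] [T2Space M] {β : ℝ → S → M}

theorem IsSmoothFamily.exists_nhds_eq_of_fibre_eq (hβ : IsSmoothFamily F E I β) (hε₀ : ε₀ ∈ I)
    {z₀ : S} (hsurj : Function.Surjective (modelDeriv F E (β ε₀) z₀)) :
    ∃ N ∈ 𝓝 z₀, ∀ᶠ ε in 𝓝[I] ε₀, ∀ z ∈ N, ∀ z' ∈ N, β ε z = β ε z' →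
      ∀ u : S → ℝ, MDifferentiable 𝓘(ℝ, F) 𝓘(ℝ, ℝ) u →
        (∀ y v, modelDeriv F E (β ε) y v = 0 → modelDeriv F ℝ u y v = 0) → u z = u z' := by
  set x₀ := β ε₀ z₀
  obtain ⟨Φ, hΦ, hΦ₀⟩ := exists_contMDiff_eventuallyEq_extChartAt (mem_chart_source E x₀)
  have hDΦ := eventually_modelDeriv_eq_tangentCoord (mem_chart_source E x₀) hΦ₀
  have hcomp : ∀ ε ∈ I, ∀ z, modelDeriv F E (Φ ∘ β ε) z =
      (modelDeriv E E Φ (β ε z)).comp (modelDeriv F E (β ε) z) := fun ε hε z =>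
    modelDeriv_comp (hΦ.mdifferentiableAt (by simp)) (hβ.mdifferentiableAt hε z)
  have hbij : ∀ᶠ x in 𝓝 x₀, Function.Bijective (modelDeriv E E Φ x) := by
    filter_upwards [hDΦ, chart_source_mem_nhds E x₀] with x hx hchart
    exact hx ▸ (isInvertible_tangentCoord hchart).bijective
  obtain ⟨U, hU, b, hb, hUb⟩ := eventually_prod_iff.1 ((hβ.tendsto hε₀ z₀).eventually hbij)
  obtain ⟨N, hN, hfib⟩ := (hβ.comp_left hΦ).exists_nhds_eq_of_fibre_eq_vector hε₀
    (by rw [hcomp ε₀ hε₀]; exact hbij.self_of_nhds.surjective.comp hsurj) hU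
  refine ⟨N, hN, ?_⟩
  filter_upwards [hfib, hb, self_mem_nhdsWithin] with ε hfib hεb hεI z hz z' hz' hzz' u hu hker
  refine hfib z hz z' hz' (congrArg Φ hzz') u hu fun y hy v hv => hker y v ?_
  rw [hcomp ε hεI] at hv
  exact (hUb hy hεb).injective (hv.trans (map_zero _).symm)

variable {σ : M → S}

theorem IsSmoothFamily.eventually_eq_section (hβ : IsSmoothFamily F E I β) (hε₀ : ε₀ ∈ I)
    (hσ : MDifferentiable 𝓘(ℝ, E) 𝓘(ℝ, F) σ) (hβσ : ∀ x, β ε₀ (σ x) = x) (x : M) :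
    ∀ᶠ p in 𝓝 (σ x) ×ˢ 𝓝[I] ε₀, β p.2 (σ (β p.2 p.1)) = β p.2 p.1 →
      ∀ u : S → ℝ, MDifferentiable 𝓘(ℝ, F) 𝓘(ℝ, ℝ) u →
        (∀ z v, modelDeriv F E (β p.2) z v = 0 → modelDeriv F ℝ u z v = 0) →
          u p.1 = u (σ (β p.2 p.1)) := by
  have hinv : (modelDeriv F E (β ε₀) (σ x)).comp (modelDeriv E F σ x) = .id ℝ E := by
    rw [← modelDeriv_comp (hβ.mdifferentiableAt hε₀ _) (hσ x),
      show β ε₀ ∘ σ = id from funext hβσ, modelDeriv_id]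
  obtain ⟨N, hN, hfib⟩ := hβ.exists_nhds_eq_of_fibre_eq hε₀ (z₀ := σ x)
    (Function.LeftInverse.surjective (g := modelDeriv E F σ x) (DFunLike.congr_fun hinv))
  have hlim : Tendsto (fun p : S × ℝ => σ (β p.2 p.1)) (𝓝 (σ x) ×ˢ 𝓝[I] ε₀) (𝓝 (σ x)) := by
    have hlimβ := hβ.tendsto hε₀ (σ x)
    rw [hβσ x] at hlimβ
    exact (hσ x).continuousAt.tendsto.comp hlimβ
  filter_upwards [tendsto_fst hN, hlim hN, tendsto_snd.eventually hfib] with p hp hp' hfib heq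
  exact hfib _ hp _ hp' heq.symm

theorem IsSmoothFamily.eventually_whitneyNhds_eq_section (hβ : IsSmoothFamily F E I β)
    (hJ : IsCompact J) (hJI : J ⊆ I) (hσ : MDifferentiable 𝓘(ℝ, E) 𝓘(ℝ, F) σ)
    (hβσ : ∀ ε ∈ J, ∀ x, β ε (σ x) = x) :
    ∀ᶠ ι in whitneyNhds E F σ,
      ∀ ε ∈ J, ∀ y, ∀ u : S → ℝ, MDifferentiable 𝓘(ℝ, F) 𝓘(ℝ, ℝ) u →
        (∀ z v, modelDeriv F E (β ε) z v = 0 → modelDeriv F ℝ u z v = 0) →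
          u (ι y) = u (σ (β ε (ι y))) := by
  filter_upwards [eventually_whitneyNhds_of_oneJet (σ := σ)
    (p := fun (j : OneJets E M F S) ε => β ε (σ (β ε j.proj.2)) = β ε j.proj.2 →
      ∀ u : S → ℝ, MDifferentiable 𝓘(ℝ, F) 𝓘(ℝ, ℝ) u →
        (∀ z v, modelDeriv F E (β ε) z v = 0 → modelDeriv F ℝ u z v = 0) →
          u j.proj.2 = u (σ (β ε j.proj.2))) hJ hJI fun x ε₀ hε₀ =>
    (((continuous_proj_oneJets.snd.tendsto (oneJet σ x)).comp tendsto_fst).prodMk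
      tendsto_snd).eventually (hβ.eventually_eq_section (hJI hε₀) hσ (hβσ ε₀ hε₀) x)]
    with ι hι ε hε y
  exact hι y ε hε (hβσ ε hε _)

end FamilyFibres

section SymplecticLinearAlgebra

theorem orthogonal_eq_of_isotropic {V : Type*} [AddCommGroup V] [Module ℝ V]
    [FiniteDimensional ℝ V] {B : LinearMap.BilinForm ℝ V} (hB : B.Nondegenerate)
    {W : Submodule ℝ V} (hW : W ≤ B.orthogonal W)
    (hdim : 2 * Module.finrank ℝ W = Module.finrank ℝ V) : B.orthogonal W = W :=
  (Submodule.eq_of_le_of_finrank_eq hW (by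
    rw [LinearMap.BilinForm.finrank_orthogonal hB]; lia)).symm

variable {F : Type*} [NormedAddCommGroup F] [NormedSpace ℝ F]
  {S : Type*} [TopologicalSpace S] [ChartedSpace F S] [IsManifold 𝓘(ℝ, F) ∞ S]
  (Ω : SymplecticForm F S)

namespace SymplecticForm

/-- The symplectic form at `z`, as a bilinear form on the model space `F` of `S`. -/
noncomputable def bilinForm (z : S) : LinearMap.BilinForm ℝ F :=
  ContinuousLinearMap.toLinearMap₁₂ (Ω.form z : F →L[ℝ] F →L[ℝ] ℝ)

theorem isAlt_bilinForm (z : S) : (Ω.bilinForm z).IsAlt :=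
  Ω.alternating z

theorem nondegenerate_bilinForm (z : S) : (Ω.bilinForm z).Nondegenerate :=
  (Ω.isAlt_bilinForm z).isRefl.nondegenerate_iff_separatingLeft.2 (Ω.nondegenerate z)

variable [FiniteDimensional ℝ F]

/-- The value at `z` of the Hamiltonian vector field `X_f`, defined by `Ω(X_f, ·) = df`, as a vector
of the model space. -/
noncomputable def hamiltonianVector (f : S → ℝ) (z : S) : F :=
  (Ω.flat z).symm (differential f z)

theorem bilinForm_hamiltonianVector (f : S → ℝ) (z : S) (v : F) :
    Ω.bilinForm z (Ω.hamiltonianVector f z) v = modelDeriv F ℝ f z v :=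
  DFunLike.congr_fun ((Ω.flat z).apply_symm_apply (differential f z)) v

theorem bracket_poissonTensor (f g : S → ℝ) (z : S) :
    bracket Ω.poissonTensor f g z = modelDeriv F ℝ g z (Ω.hamiltonianVector f z) := rfl

end SymplecticForm

end SymplecticLinearAlgebra

section Realizations

variable {E : Type*} [NormedAddCommGroup E] [NormedSpace ℝ E]
  {M : Type*} [TopologicalSpace M] [ChartedSpace E M]

theorem eq_zero_of_forall_modelDeriv_eq_zero [FiniteDimensional ℝ E] [IsManifold 𝓘(ℝ, E) ∞ M]
    [T2Space M] {x : M} {v : E}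
    (h : ∀ g : M → ℝ, IsSmoothFun E g → modelDeriv E ℝ g x v = 0) : v = 0 := by
  obtain ⟨Φ, hΦ, hΦx⟩ := exists_contMDiff_eventuallyEq_extChartAt (mem_chart_source E x)
  have hDΦ := (eventually_modelDeriv_eq_tangentCoord (mem_chart_source E x) hΦx).self_of_nhds
  refine (isInvertible_tangentCoord (mem_chart_source E x)).injective
    (Eq.trans ?_ (map_zero _).symm)
  refine SeparatingDual.eq_zero_of_forall_dual_eq_zero (R := ℝ) fun ξ : E →L[ℝ] ℝ => ?_
  have hξ := h (ξ ∘ Φ) (ξ.contDiff.contMDiff.comp hΦ)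
  rwa [modelDeriv_comp ξ.differentiableAt.mdifferentiableAt (hΦ.mdifferentiableAt (by simp)),
    modelDeriv_eq_fderiv, ξ.fderiv, hDΦ] at hξ

variable {F : Type*} [NormedAddCommGroup F] [NormedSpace ℝ F] [FiniteDimensional ℝ F]
  {S : Type*} [TopologicalSpace S] [ChartedSpace F S] [IsManifold 𝓘(ℝ, F) ∞ S]
  {Ω : SymplecticForm F S} {P : TwoTensorField E M} {α β : S → M} {σ ι : M → S}

namespace IsRealizationData

theorem mdifferentiable_left (hR : IsRealizationData Ω P α β σ) :
    MDifferentiable 𝓘(ℝ, F) 𝓘(ℝ, E) α :=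
  hR.poisson.smooth.mdifferentiable (by simp)

theorem mdifferentiable_right (hR : IsRealizationData Ω P α β σ) :
    MDifferentiable 𝓘(ℝ, F) 𝓘(ℝ, E) β :=
  hR.antiPoisson.smooth.mdifferentiable (by simp)

theorem modelDeriv_left_eq_zero_iff (hR : IsRealizationData Ω P α β σ) (z : S) (v : F) :
    modelDeriv F E α z v = 0 ↔ ∀ w, modelDeriv F E β z w = 0 → Ω.bilinForm z v w = 0 :=
  (hR.orthogonal z v).trans (forall₂_congr fun w _ => (Ω.isAlt_bilinForm z).isRefl.eq_iff (x := w))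

theorem modelDeriv_comp_eq_zero_of_isCasimir [FiniteDimensional ℝ E] [IsManifold 𝓘(ℝ, E) ∞ M]
    [T2Space M] (hR : IsRealizationData Ω P α β σ) {C : M → ℝ} (hC : IsCasimir P C) {z : S} {v : F}
    (hv : modelDeriv F E β z v = 0) : modelDeriv F ℝ (C ∘ α) z v = 0 := by
  have hDα : modelDeriv F E α z (Ω.hamiltonianVector (C ∘ α) z) = 0 :=
    eq_zero_of_forall_modelDeriv_eq_zero fun g hg => by
      have hbr := hR.poisson.map_bracket C g hC.smooth hg z
      rwa [hC.bracket_eq_zero g hg, Ω.bracket_poissonTensor, modelDeriv_comp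
        (hg.mdifferentiableAt (by simp)) (hR.mdifferentiable_left z)] at hbr
  rw [← Ω.bilinForm_hamiltonianVector]
  exact (hR.modelDeriv_left_eq_zero_iff z _).1 hDα v hv

theorem modelDeriv_left_hamiltonianVector_comp_right (hR : IsRealizationData Ω P α β σ) {g : M → ℝ}
    (hg : IsSmoothFun E g) (z : S) :
    modelDeriv F E α z (Ω.hamiltonianVector (g ∘ β) z) = 0 := by
  refine (hR.modelDeriv_left_eq_zero_iff z _).2 fun w hw => ?_
  rw [Ω.bilinForm_hamiltonianVector, modelDeriv_comp (hg.mdifferentiableAt (by simp))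
    (hR.mdifferentiable_right z), ContinuousLinearMap.comp_apply, hw, map_zero]

theorem bilinForm_hamiltonianVector_left_right (hR : IsRealizationData Ω P α β σ) {f g : M → ℝ}
    (hf : IsSmoothFun E f) (hg : IsSmoothFun E g) (z : S) :
    Ω.bilinForm z (Ω.hamiltonianVector (f ∘ α) z) (Ω.hamiltonianVector (g ∘ β) z) = 0 := by
  rw [Ω.bilinForm_hamiltonianVector, modelDeriv_comp (hf.mdifferentiableAt (by simp))
    (hR.mdifferentiable_left z), ContinuousLinearMap.comp_apply,
    hR.modelDeriv_left_hamiltonianVector_comp_right hg, map_zero]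

end IsRealizationData

theorem orthogonal_range_modelDeriv (hι : IsLagrangianEmbedding (E := E) Ω ι) {y : M}
    (hinj : Function.Injective (modelDeriv E F ι y)) :
    (Ω.bilinForm (ι y)).orthogonal (modelDeriv E F ι y).range = (modelDeriv E F ι y).range := by
  refine orthogonal_eq_of_isotropic (Ω.nondegenerate_bilinForm _) ?_
    ((congrArg (2 * ·) (LinearMap.finrank_range_of_inj hinj)).trans hι.half_dim)
  rintro _ ⟨v, rfl⟩ _ ⟨w, rfl⟩
  exact hι.isotropic y w v

variable {y : M} {f f₁ f₂ g g₁ g₂ : M → ℝ}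

theorem hamiltonianVector_sub_mem_range (hR : IsRealizationData Ω P α β σ)
    (hι : IsLagrangianEmbedding (E := E) Ω ι) (hinj : Function.Injective (modelDeriv E F ι y))
    (hf : IsSmoothFun E f) (hg : IsSmoothFun E g) (hfg : f ∘ α ∘ ι = g ∘ β ∘ ι) :
    Ω.hamiltonianVector (f ∘ α) (ι y) - Ω.hamiltonianVector (g ∘ β) (ι y) ∈
      (modelDeriv E F ι y).range := by
  have hιy : MDifferentiableAt 𝓘(ℝ, E) 𝓘(ℝ, F) ι y :=
    hι.embedding.contMDiff.mdifferentiableAt (by simp)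
  have hD : (modelDeriv F ℝ (f ∘ α) (ι y)).comp (modelDeriv E F ι y) =
      (modelDeriv F ℝ (g ∘ β) (ι y)).comp (modelDeriv E F ι y) := by
    rw [← modelDeriv_comp ((hf.comp hR.poisson.smooth).mdifferentiableAt (by simp)) hιy,
      ← modelDeriv_comp ((hg.comp hR.antiPoisson.smooth).mdifferentiableAt (by simp)) hιy]
    exact congrArg (modelDeriv E ℝ · y) hfg
  rw [← orthogonal_range_modelDeriv hι hinj]
  rintro _ ⟨v, rfl⟩
  refine (Ω.isAlt_bilinForm _).isRefl _ _ ?_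
  rw [map_sub, LinearMap.sub_apply, Ω.bilinForm_hamiltonianVector, Ω.bilinForm_hamiltonianVector]
  exact sub_eq_zero.2 (DFunLike.congr_fun hD v)

theorem bracket_eq_of_lagrangian (hR : IsRealizationData Ω P α β σ)
    (hι : IsLagrangianEmbedding (E := E) Ω ι) (hinj : Function.Injective (modelDeriv E F ι y))
    (hf₁ : IsSmoothFun E f₁) (hg₁ : IsSmoothFun E g₁) (hfg₁ : f₁ ∘ α ∘ ι = g₁ ∘ β ∘ ι)
    (hf₂ : IsSmoothFun E f₂) (hg₂ : IsSmoothFun E g₂) (hfg₂ : f₂ ∘ α ∘ ι = g₂ ∘ β ∘ ι) :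
    bracket P f₁ f₂ (α (ι y)) = bracket P g₁ g₂ (β (ι y)) := by
  have hmem := (orthogonal_range_modelDeriv hι hinj).ge
    (hamiltonianVector_sub_mem_range hR hι hinj hf₂ hg₂ hfg₂) _
    (hamiltonianVector_sub_mem_range hR hι hinj hf₁ hg₁ hfg₁)
  have hα : Ω.bilinForm (ι y) (Ω.hamiltonianVector (f₁ ∘ α) (ι y))
      (Ω.hamiltonianVector (f₂ ∘ α) (ι y)) = -bracket P f₁ f₂ (α (ι y)) := by
    rw [← (Ω.isAlt_bilinForm _).neg_eq, Ω.bilinForm_hamiltonianVector, ← Ω.bracket_poissonTensor,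
      hR.poisson.map_bracket f₁ f₂ hf₁ hf₂]
  have hβ : Ω.bilinForm (ι y) (Ω.hamiltonianVector (g₁ ∘ β) (ι y))
      (Ω.hamiltonianVector (g₂ ∘ β) (ι y)) = bracket P g₁ g₂ (β (ι y)) := by
    rw [← (Ω.isAlt_bilinForm _).neg_eq, Ω.bilinForm_hamiltonianVector, ← Ω.bracket_poissonTensor,
      hR.antiPoisson.map_bracket g₁ g₂ hg₁ hg₂]
    exact neg_neg _
  have hβα := (Ω.isAlt_bilinForm _).isRefl _ _
    (hR.bilinForm_hamiltonianVector_left_right hf₂ hg₁ (ι y))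
  simp only [map_sub, LinearMap.sub_apply, hα, hβ, hβα,
    hR.bilinForm_hamiltonianVector_left_right hf₁ hg₂] at hmem
  linarith

end Realizations

section UniformEstimates

variable {X Y : Type*} [TopologicalSpace X] [TopologicalSpace Y] {I J : Set ℝ} {k n : ℕ}
  {r : ℝ → X → ℝ}

theorem isUniformO_iff_eventually : IsUniformO I k r ↔
    ∀ K, IsCompact K → ∃ C, ∀ᶠ ε in 𝓝[I] 0, ∀ x ∈ K, |r ε x| ≤ C * |ε| ^ k := by
  refine forall₂_congr fun K _ => exists_congr fun C => ?_
  simp only [Metric.nhdsWithin_basis_ball.eventually_iff, mem_inter_iff, mem_ball_zero_iff,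
    Real.norm_eq_abs]
  grind

theorem IsUniformO.comp_continuous (hr : IsUniformO I k r) {φ : Y → X} (hφ : Continuous φ) :
    IsUniformO I k fun ε y => r ε (φ y) := fun K hK => by
  obtain ⟨C, δ, hδ, hC⟩ := hr _ (hK.image hφ)
  exact ⟨C, δ, hδ, fun ε hε hεδ y hy => hC ε hε hεδ _ (mem_image_of_mem φ hy)⟩

theorem IsUniformO.isBigO [LocallyCompactSpace X] (hr : IsUniformO I k r) (x₀ : X) :
    (fun p : X × ℝ => r p.2 p.1) =O[𝓝 x₀ ×ˢ 𝓝[I] 0] fun p => p.2 ^ k := by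
  obtain ⟨K, hK, hx₀⟩ := exists_compact_mem_nhds x₀
  obtain ⟨C, hC⟩ := isUniformO_iff_eventually.1 hr K hK
  refine .of_bound C ?_
  filter_upwards [prod_mem_prod hx₀ hC] with p hp
  simpa using hp.2 p.1 hp.1

theorem IsUniformO.isBigO_apply (hr : IsUniformO I k r) (x : X) :
    (fun ε => r ε x) =O[𝓝[I] 0] fun ε => ε ^ k := by
  obtain ⟨C, hC⟩ := isUniformO_iff_eventually.1 hr {x} isCompact_singleton
  exact .of_bound C (hC.mono fun ε hε => by simpa using hε x rfl)

theorem exists_eventually_le_of_isBigO (hr : ∀ x₀,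
    (fun p : X × ℝ => r p.2 p.1) =O[𝓝 x₀ ×ˢ 𝓝[I] 0] fun p => p.2 ^ k) {K : Set X}
    (hK : IsCompact K) : ∃ C, ∀ᶠ ε in 𝓝[I] 0, ∀ x ∈ K, |r ε x| ≤ C * |ε| ^ k := by
  refine hK.induction_on ⟨0, by simp⟩ (fun s t hst ⟨C, hC⟩ =>
    ⟨C, hC.mono fun ε h x hx => h x (hst hx)⟩) (fun s t ⟨C, hC⟩ ⟨D, hD⟩ => ⟨max C D, ?_⟩)
    fun x₀ _ => ?_
  · filter_upwards [hC, hD] with ε hC hD x hx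
    rcases hx with hx | hx
    · exact (hC x hx).trans (by gcongr; exact le_max_left C D)
    · exact (hD x hx).trans (by gcongr; exact le_max_right C D)
  · obtain ⟨C, hC⟩ := (hr x₀).bound
    obtain ⟨u, hu, l, hl, hul⟩ := eventually_prod_iff.1 hC
    exact ⟨{x | u x}, mem_nhdsWithin_of_mem_nhds hu, C,
      hl.mono fun ε hε x hx => by simpa using hul hx hε⟩

theorem isUniformO_of_isBigO_comp (hJ0 : J ∈ 𝓝[I] 0) {b : ℝ → Y → X}
    (hb : ∀ ε ∈ J, Function.Surjective (b ε))
    (hproper : ∀ K : Set X, IsCompact K → ∃ K' : Set Y, IsCompact K' ∧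
      ∀ ε ∈ J, ∀ y, b ε y ∈ K → y ∈ K')
    (hr : ∀ y₀, (fun p : Y × ℝ => r p.2 (b p.2 p.1)) =O[𝓝 y₀ ×ˢ 𝓝[I] 0] fun p => p.2 ^ k) :
    IsUniformO I k r := isUniformO_iff_eventually.2 fun K hK => by
  obtain ⟨K', hK', hKK'⟩ := hproper K hK
  obtain ⟨C, hC⟩ := exists_eventually_le_of_isBigO (r := fun ε y => r ε (b ε y)) hr hK'
  refine ⟨C, ?_⟩
  filter_upwards [hC, hJ0] with ε hε hεJ x hx
  obtain ⟨y, rfl⟩ := hb ε hεJ x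
  exact hε y (hKK' ε hεJ y hx)

variable {E : Type*} [NormedAddCommGroup E] [NormedSpace ℝ E]
  {M : Type*} [TopologicalSpace M] [ChartedSpace E M]

theorem IsApproximation.comp_continuous {f f' : ℝ → X → M} (h : IsApproximation E I n f f')
    {φ : Y → X} (hφ : Continuous φ) :
    IsApproximation E I n (fun ε => f ε ∘ φ) (fun ε => f' ε ∘ φ) :=
  fun g hg => (h g hg).comp_continuous hφ

variable [FiniteDimensional ℝ E] [IsManifold 𝓘(ℝ, E) ∞ M] [T2Space M]

theorem eq_of_forall_isSmoothFun_eq {p q : M}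
    (h : ∀ g : M → ℝ, IsSmoothFun E g → g p = g q) : p = q := by
  by_contra hne
  obtain ⟨f, -, hf⟩ := (SmoothBumpFunction.nhds_basis_tsupport (I := 𝓘(ℝ, E)) p).mem_iff.1
    (isOpen_compl_singleton.mem_nhds hne)
  have hfq := h f f.contMDiff
  rw [f.eq_one, image_eq_zero_of_notMem_tsupport fun hq => hf hq rfl] at hfq
  exact one_ne_zero hfq

theorem IsApproximation.eq_zero {f f' : ℝ → X → M} (h : IsApproximation E I n f f')
    (h0 : 0 ∈ I) : f 0 = f' 0 := by
  refine funext fun x => eq_of_forall_isSmoothFun_eq (E := E) fun g hg => ?_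
  obtain ⟨C, δ, hδ, hC⟩ := h g hg {x} isCompact_singleton
  have hx := hC 0 h0 (by simpa using hδ) x rfl
  rw [abs_zero, zero_pow n.succ_ne_zero, mul_zero] at hx
  exact sub_eq_zero.1 (abs_nonpos_iff.1 hx)

end UniformEstimates

section Pullbacks

variable {E : Type*} [NormedAddCommGroup E] [NormedSpace ℝ E]
  {M : Type*} [TopologicalSpace M] [ChartedSpace E M] {P : TwoTensorField E M}
  {φ a b : M → M} {Φ : M → E} {f g : M → ℝ} {x y : M}

/-- Smoothness of a contravariant 2-tensor field, tested on the differentials of functions. -/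
def IsSmoothTensor (P : TwoTensorField E M) : Prop :=
  ∀ f g : M → ℝ, IsSmoothFun E f → IsSmoothFun E g → IsSmoothFun E (bracket P f g)

/-- The bilinear form `P_x` on covectors of the model space `E`, with which the tangent space at `x`
is identified by the preferred chart at `x`; it is to `P` what `modelDeriv` is to `mfderiv`. -/
def modelTensor (P : TwoTensorField E M) (x : M) : (E →L[ℝ] ℝ) →ₗ[ℝ] (E →L[ℝ] ℝ) →ₗ[ℝ] ℝ := P x

theorem bracket_eq_modelTensor (P : TwoTensorField E M) (f g : M → ℝ) (x : M) :
    bracket P f g x = modelTensor P x (modelDeriv E ℝ f x) (modelDeriv E ℝ g x) := rfl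

theorem bracket_pullbackTensor (φ : M → M) (P : TwoTensorField E M) (f g : M → ℝ) (y : M) :
    bracket (pullbackTensor φ P) f g y =
      modelTensor P (φ y) ((modelDeriv E ℝ f y).comp (modelDeriv E E φ y).inverse)
        ((modelDeriv E ℝ g y).comp (modelDeriv E E φ y).inverse) := rfl

theorem bracket_pullbackTensor_comp (hφ : MDifferentiableAt 𝓘(ℝ, E) 𝓘(ℝ, E) φ (b y))
    (hb : MDifferentiableAt 𝓘(ℝ, E) 𝓘(ℝ, E) b y) (hDb : (modelDeriv E E b y).IsInvertible)
    (hf : MDifferentiableAt 𝓘(ℝ, E) 𝓘(ℝ, ℝ) f (b y))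
    (hg : MDifferentiableAt 𝓘(ℝ, E) 𝓘(ℝ, ℝ) g (b y)) :
    bracket (pullbackTensor (φ ∘ b) P) (f ∘ b) (g ∘ b) y =
      bracket (pullbackTensor φ P) f g (b y) := by
  have hcov (u : M → ℝ) (hu : MDifferentiableAt 𝓘(ℝ, E) 𝓘(ℝ, ℝ) u (b y)) :
      (modelDeriv E ℝ (u ∘ b) y).comp (modelDeriv E E (φ ∘ b) y).inverse =
        (modelDeriv E ℝ u (b y)).comp (modelDeriv E E φ (b y)).inverse := by
    rw [modelDeriv_comp hu hb, modelDeriv_comp hφ hb, hDb.inverse_comp_of_right,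
      ContinuousLinearMap.comp_assoc, ← ContinuousLinearMap.comp_assoc (modelDeriv E E b y),
      hDb.self_comp_inverse, ContinuousLinearMap.id_comp]
  rw [bracket_pullbackTensor, bracket_pullbackTensor, hcov f hf, hcov g hg, Function.comp_apply]

theorem bracket_pullbackTensor_comp_self (ha : MDifferentiableAt 𝓘(ℝ, E) 𝓘(ℝ, E) a y)
    (hDa : (modelDeriv E E a y).IsInvertible)
    (hf : MDifferentiableAt 𝓘(ℝ, E) 𝓘(ℝ, ℝ) f (a y))
    (hg : MDifferentiableAt 𝓘(ℝ, E) 𝓘(ℝ, ℝ) g (a y)) :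
    bracket (pullbackTensor a P) (f ∘ a) (g ∘ a) y = bracket P f g (a y) := by
  have hcov (u : M → ℝ) (hu : MDifferentiableAt 𝓘(ℝ, E) 𝓘(ℝ, ℝ) u (a y)) :
      (modelDeriv E ℝ (u ∘ a) y).comp (modelDeriv E E a y).inverse = modelDeriv E ℝ u (a y) := by
    rw [modelDeriv_comp hu ha, ContinuousLinearMap.comp_assoc, hDa.self_comp_inverse,
      ContinuousLinearMap.comp_id]
  rw [bracket_pullbackTensor, hcov f hf, hcov g hg, bracket_eq_modelTensor]

variable {κ : Type*} (bas : Module.Basis κ ℝ E)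

theorem isSmoothFun_bracket_coord [FiniteDimensional ℝ E] (hP : IsSmoothTensor P)
    (hΦ : ContMDiff 𝓘(ℝ, E) 𝓘(ℝ, E) ∞ Φ) (i j : κ) :
    IsSmoothFun E (bracket P (bas.coord i ∘ Φ) (bas.coord j ∘ Φ)) :=
  have hcoord (i : κ) : IsSmoothFun E (bas.coord i ∘ Φ) :=
    (LinearMap.toContinuousLinearMap (bas.coord i)).contDiff.contMDiff.comp hΦ
  hP _ _ (hcoord i) (hcoord j)

section Pairing

variable [Fintype κ]

/-- The value on a pair of covectors `c`, `d` of a bivector that has been pulled back by a linear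
map `A` and has the components `G` in the basis `bas`; the argument is `(A, c, d, G)`. -/
noncomputable def pullbackPairing
    (q : (E →L[ℝ] E) × (E →L[ℝ] ℝ) × (E →L[ℝ] ℝ) × (κ → κ → ℝ)) : ℝ :=
  ∑ i, ∑ j, q.2.1 (q.1.inverse (bas i)) * q.2.2.1 (q.1.inverse (bas j)) * q.2.2.2 i j

theorem contDiffAt_pullbackPairing [CompleteSpace E]
    {q : (E →L[ℝ] E) × (E →L[ℝ] ℝ) × (E →L[ℝ] ℝ) × (κ → κ → ℝ)} (hq : q.1.IsInvertible) :
    ContDiffAt ℝ 1 (pullbackPairing bas) q := by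
  have hinv := (hq.contDiffAt_map_inverse (n := 1)).comp q contDiffAt_fst
  have hvec (i : κ) : ContDiffAt ℝ 1 (fun q : (E →L[ℝ] E) × (E →L[ℝ] ℝ) × (E →L[ℝ] ℝ) ×
      (κ → κ → ℝ) => q.1.inverse (bas i)) q := hinv.clm_apply contDiffAt_const
  refine ContDiffAt.sum fun i _ => ContDiffAt.sum fun j _ =>
    ContDiffAt.mul (ContDiffAt.mul ?_ ?_) ?_
  · exact contDiffAt_snd.fst.clm_apply (hvec i)
  · exact contDiffAt_snd.snd.fst.clm_apply (hvec j)
  · exact contDiffAt_pi.1 (contDiffAt_pi.1 contDiffAt_snd.snd.snd i) j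

theorem sum_smul_modelDeriv_coord_comp (hΦ : MDifferentiableAt 𝓘(ℝ, E) 𝓘(ℝ, E) Φ x)
    (hDΦ : (modelDeriv E E Φ x).IsInvertible) (ξ : E →L[ℝ] ℝ) :
    ∑ i, ξ ((modelDeriv E E Φ x).inverse (bas i)) • modelDeriv E ℝ (bas.coord i ∘ Φ) x = ξ := by
  have : FiniteDimensional ℝ E := bas.finiteDimensional_of_finite
  have hcoord (i : κ) (v : E) : modelDeriv E ℝ (bas.coord i ∘ Φ) x v =
      bas.repr (modelDeriv E E Φ x v) i := by
    have hi : HasFDerivAt (bas.coord i) (LinearMap.toContinuousLinearMap (bas.coord i)) (Φ x) :=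
      (LinearMap.toContinuousLinearMap (bas.coord i)).hasFDerivAt
    rw [modelDeriv_comp hi.differentiableAt.mdifferentiableAt hΦ, modelDeriv_eq_fderiv]
    rw [hi.fderiv]; rfl
  ext v
  calc (∑ i, ξ ((modelDeriv E E Φ x).inverse (bas i)) • modelDeriv E ℝ (bas.coord i ∘ Φ) x) v
      = ξ ((modelDeriv E E Φ x).inverse
          (∑ i, bas.repr (modelDeriv E E Φ x v) i • bas i)) := by
        simp only [sum_apply, smul_apply, hcoord, map_sum, map_smul,
          smul_eq_mul, mul_comm]
    _ = ξ v := by rw [bas.sum_repr, hDΦ.inverse_apply_self]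

theorem bracket_pullbackTensor_eq_pullbackPairing
    (hφ : MDifferentiableAt 𝓘(ℝ, E) 𝓘(ℝ, E) φ y) (hΦ : MDifferentiableAt 𝓘(ℝ, E) 𝓘(ℝ, E) Φ (φ y))
    (hDΦ : (modelDeriv E E Φ (φ y)).IsInvertible) {T : E →L[ℝ] E} (hT : T.IsInvertible) :
    bracket (pullbackTensor φ P) f g y =
      pullbackPairing bas ((modelDeriv E E (Φ ∘ φ) y).comp T, (modelDeriv E ℝ f y).comp T,
        (modelDeriv E ℝ g y).comp T,
        fun i j => bracket P (bas.coord i ∘ Φ) (bas.coord j ∘ Φ) (φ y)) := by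
  have hinv (i : κ) : T (((modelDeriv E E (Φ ∘ φ) y).comp T).inverse (bas i)) =
      (modelDeriv E E φ y).inverse ((modelDeriv E E Φ (φ y)).inverse (bas i)) := by
    rw [hT.inverse_comp_apply_of_right, hT.self_apply_inverse, modelDeriv_comp hΦ hφ,
      hDΦ.inverse_comp_apply_of_left]
  rw [bracket_pullbackTensor, ← sum_smul_modelDeriv_coord_comp bas hΦ hDΦ
      ((modelDeriv E ℝ f y).comp _), ← sum_smul_modelDeriv_coord_comp bas hΦ hDΦ
      ((modelDeriv E ℝ g y).comp _), LinearMap.map_sum₂]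
  refine Finset.sum_congr rfl fun i _ => (map_sum _ _ _).trans (Finset.sum_congr rfl fun j _ => ?_)
  simp only [map_smul, LinearMap.smul_apply, smul_eq_mul, ContinuousLinearMap.comp_apply, hinv,
    mul_assoc, mul_left_comm, bracket_eq_modelTensor]

end Pairing

variable {I : Set ℝ} {n : ℕ}

theorem IsApproximation.isBigO_sub {X G : Type*} [TopologicalSpace X] [NormedAddCommGroup G]
    [NormedSpace ℝ G] [FiniteDimensional ℝ G] {a a' : ℝ → X → M} (h : IsApproximation E I n a a')
    {Φ : M → G} (hΦ : ContMDiff 𝓘(ℝ, E) 𝓘(ℝ, G) ∞ Φ) (x : X) :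
    (fun ε => Φ (a ε x) - Φ (a' ε x)) =O[𝓝[I] 0] fun ε => ε ^ (n + 1) := by
  set e := (Module.finBasis ℝ G).equivFunL
  have hcoord : (fun ε => e (Φ (a ε x) - Φ (a' ε x))) =O[𝓝[I] 0] fun ε => ε ^ (n + 1) := by
    refine isBigO_pi.2 fun i => ?_
    have heΦ : IsSmoothFun E (fun w => e (Φ w) i) :=
      (contDiff_pi.1 e.contDiff i).contMDiff.comp hΦ
    have hi := (h _ heΦ).isBigO_apply x
    simpa only [map_sub, Pi.sub_apply] using hi
  simpa only [Function.comp_def, e.symm_apply_apply] using (e.symm.isBigO_comp _ _).trans hcoord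

theorem IsApproximation.isBigO_modelDeriv_sub [IsManifold 𝓘(ℝ, E) ∞ M] {G : Type*}
    [NormedAddCommGroup G] [NormedSpace ℝ G] [FiniteDimensional ℝ G] (hI : Convex ℝ I)
    (hI' : I.Nontrivial) (h0 : (0 : ℝ) ∈ I) {a a' : ℝ → M → M} (ha : IsSmoothFamily E E I a)
    (ha' : IsSmoothFamily E E I a') (h : IsApproximation E I n a a') {Φ : M → G}
    (hΦ : ContMDiff 𝓘(ℝ, E) 𝓘(ℝ, G) ∞ Φ) (y₀ : M) :
    (fun p : M × ℝ => (modelDeriv E G (Φ ∘ a p.2) p.1).comp (tangentCoordSymm y₀ p.1) -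
      (modelDeriv E G (Φ ∘ a' p.2) p.1).comp (tangentCoordSymm y₀ p.1))
      =O[𝓝 y₀ ×ˢ 𝓝[I] 0] fun p => p.2 ^ (n + 1) :=
  (ha.comp_left hΦ).modelDeriv_sub_isBigO hI hI' h0 (ha'.comp_left hΦ) (h.isBigO_sub hΦ) y₀

/-- The data that determine `{f ∘ b_ε, g ∘ b_ε}` for the pulled back tensor `a_ε^* P`, as an
argument of `pullbackPairing`: the coordinates are `Φ` at the image points of `a_ε` and the
preferred chart at `y₀` at the points of its source. -/
noncomputable def pullbackData (P : TwoTensorField E M) [IsManifold 𝓘(ℝ, E) ∞ M] (Φ : M → E)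
    (f g : M → ℝ) (a b : ℝ → M → M) (y₀ : M) (p : M × ℝ) :
    (E →L[ℝ] E) × (E →L[ℝ] ℝ) × (E →L[ℝ] ℝ) × (κ → κ → ℝ) :=
  ((modelDeriv E E (Φ ∘ a p.2) p.1).comp (tangentCoordSymm y₀ p.1),
    (modelDeriv E ℝ (f ∘ b p.2) p.1).comp (tangentCoordSymm y₀ p.1),
    (modelDeriv E ℝ (g ∘ b p.2) p.1).comp (tangentCoordSymm y₀ p.1),
    fun i j => bracket P (bas.coord i ∘ Φ) (bas.coord j ∘ Φ) (a p.2 p.1))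

section Estimates

variable [IsManifold 𝓘(ℝ, E) ∞ M] {a a' b b' : ℝ → M → M}

theorem tendsto_pullbackData [FiniteDimensional ℝ E] (hP : IsSmoothTensor P) (h0 : (0 : ℝ) ∈ I)
    (ha : IsSmoothFamily E E I a) (hb : IsSmoothFamily E E I b)
    (hΦ : ContMDiff 𝓘(ℝ, E) 𝓘(ℝ, E) ∞ Φ) (hf : IsSmoothFun E f) (hg : IsSmoothFun E g) (y₀ : M) :
    Tendsto (pullbackData bas P Φ f g a b y₀) (𝓝 y₀ ×ˢ 𝓝[I] 0)
      (𝓝 (pullbackData bas P Φ f g a b y₀ (y₀, 0))) :=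
  ((ha.comp_left hΦ).tendsto_modelDeriv_vector h0 y₀).prodMk_nhds <|
    ((hb.comp_left hf).tendsto_modelDeriv_vector h0 y₀).prodMk_nhds <|
    ((hb.comp_left hg).tendsto_modelDeriv_vector h0 y₀).prodMk_nhds <|
    tendsto_pi_nhds.2 fun i => tendsto_pi_nhds.2 fun j =>
      ((isSmoothFun_bracket_coord bas hP hΦ i j).continuous.tendsto _).comp (ha.tendsto h0 y₀)

variable [Fintype κ]

theorem eventually_bracket_pullbackTensor_eq_pullbackPairing (h0 : (0 : ℝ) ∈ I)
    (ha : IsSmoothFamily E E I a) (hΦ : ContMDiff 𝓘(ℝ, E) 𝓘(ℝ, E) ∞ Φ) {y₀ : M}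
    (hΦ₀ : Φ =ᶠ[𝓝 (a 0 y₀)] extChartAt 𝓘(ℝ, E) (a 0 y₀)) :
    ∀ᶠ p : M × ℝ in 𝓝 y₀ ×ˢ 𝓝[I] 0,
      bracket (pullbackTensor (a p.2) P) (f ∘ b p.2) (g ∘ b p.2) p.1 =
        pullbackPairing bas (pullbackData bas P Φ f g a b y₀ p) := by
  have hx₀ := mem_chart_source E (a 0 y₀)
  filter_upwards [(ha.tendsto h0 y₀).eventually ((eventually_modelDeriv_eq_tangentCoord hx₀ hΦ₀).and
      (chart_source_mem_nhds E (a 0 y₀))),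
    prod_mem_prod (chart_source_mem_nhds E y₀) self_mem_nhdsWithin] with p ⟨hDΦ, hap⟩ hp
  exact bracket_pullbackTensor_eq_pullbackPairing bas (ha.mdifferentiableAt hp.2 p.1)
    (hΦ.mdifferentiableAt (by simp)) (hDΦ ▸ isInvertible_tangentCoord hap)
    (isInvertible_tangentCoordSymm hp.1)

variable [FiniteDimensional ℝ E]

theorem isBigO_pullbackData_sub (hP : IsSmoothTensor P) (hI : Convex ℝ I) (hI' : I.Nontrivial)
    (h0 : (0 : ℝ) ∈ I) (ha : IsSmoothFamily E E I a) (ha' : IsSmoothFamily E E I a')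
    (haa' : IsApproximation E I n a a') (hb : IsSmoothFamily E E I b)
    (hb' : IsSmoothFamily E E I b') (hbb' : IsApproximation E I n b b')
    (hΦ : ContMDiff 𝓘(ℝ, E) 𝓘(ℝ, E) ∞ Φ) (hf : IsSmoothFun E f) (hg : IsSmoothFun E g) (y₀ : M) :
    (fun p => pullbackData bas P Φ f g a b y₀ p - pullbackData bas P Φ f g a' b' y₀ p)
      =O[𝓝 y₀ ×ˢ 𝓝[I] 0] fun p => p.2 ^ (n + 1) :=
  have : LocallyCompactSpace M := ChartedSpace.locallyCompactSpace E M
  (haa'.isBigO_modelDeriv_sub hI hI' h0 ha ha' hΦ y₀).prod_left <|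
    (hbb'.isBigO_modelDeriv_sub hI hI' h0 hb hb' hf y₀).prod_left <|
    (hbb'.isBigO_modelDeriv_sub hI hI' h0 hb hb' hg y₀).prod_left <|
    isBigO_pi.2 fun i => isBigO_pi.2 fun j =>
      (haa' _ (isSmoothFun_bracket_coord bas hP hΦ i j)).isBigO y₀

theorem isBigO_bracket_pullbackTensor_sub [T2Space M] (hP : IsSmoothTensor P) (hI : Convex ℝ I)
    (hI' : I.Nontrivial) (h0 : (0 : ℝ) ∈ I) (ha : IsSmoothFamily E E I a)
    (ha' : IsSmoothFamily E E I a') (haa' : IsApproximation E I n a a')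
    (hb : IsSmoothFamily E E I b) (hb' : IsSmoothFamily E E I b')
    (hbb' : IsApproximation E I n b b') (hf : IsSmoothFun E f) (hg : IsSmoothFun E g) {y₀ : M}
    (hDa : (modelDeriv E E (a 0) y₀).IsInvertible) :
    (fun p : M × ℝ => bracket (pullbackTensor (a p.2) P) (f ∘ b p.2) (g ∘ b p.2) p.1 -
      bracket (pullbackTensor (a' p.2) P) (f ∘ b' p.2) (g ∘ b' p.2) p.1)
      =O[𝓝 y₀ ×ˢ 𝓝[I] 0] fun p => p.2 ^ (n + 1) := by
  obtain ⟨Φ, hΦ, hΦ₀⟩ := exists_contMDiff_eventuallyEq_extChartAt (mem_chart_source E (a 0 y₀))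
  set bas := Module.finBasis ℝ E
  have hcompl : CompleteSpace E := FiniteDimensional.complete ℝ E
  have ha0 : a 0 = a' 0 := haa'.eq_zero h0
  have hb0 : b 0 = b' 0 := hbb'.eq_zero h0
  have hdata : pullbackData bas P Φ f g a b y₀ (y₀, 0) =
      pullbackData bas P Φ f g a' b' y₀ (y₀, 0) := by
    simp only [pullbackData, ha0, hb0]
  have hinv : (pullbackData bas P Φ f g a b y₀ (y₀, 0)).1.IsInvertible := by
    have hx₀ := mem_chart_source E (a 0 y₀)
    have hDΦ := (eventually_modelDeriv_eq_tangentCoord hx₀ hΦ₀).self_of_nhds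
    rw [pullbackData, modelDeriv_comp (hΦ.mdifferentiableAt (by simp))
      (ha.mdifferentiableAt h0 y₀), hDΦ]
    exact ((isInvertible_tangentCoord hx₀).comp hDa).comp
      (isInvertible_tangentCoordSymm (mem_chart_source E y₀))
  have hlip := ((contDiffAt_pullbackPairing bas hinv).hasStrictFDerivAt one_ne_zero).isBigO_sub
  have hlim := (tendsto_pullbackData bas hP h0 ha hb hΦ hf hg y₀).prodMk_nhds
    (hdata ▸ tendsto_pullbackData bas hP h0 ha' hb' hΦ hf hg y₀)
  refine ((hlip.comp_tendsto hlim).trans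
    (isBigO_pullbackData_sub bas hP hI hI' h0 ha ha' haa' hb hb' hbb' hΦ hf hg y₀)).congr' ?_ .rfl
  filter_upwards [eventually_bracket_pullbackTensor_eq_pullbackPairing bas h0 ha hΦ hΦ₀,
    eventually_bracket_pullbackTensor_eq_pullbackPairing bas h0 ha' hΦ (ha0 ▸ hΦ₀)] with p hp hp'
  rw [hp, hp']
  rfl

end Estimates

end Pullbacks

section InducedMaps

theorem inducedMap_range_comp {S M : Type*} {α β : S → M} {ι : M → S}
    (hβ : Function.Injective (β ∘ ι)) :
    inducedMap α β (range ι) ∘ β ∘ ι = α ∘ ι := by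
  ext y
  have hex : ∃ z ∈ range ι, β z = β (ι y) := ⟨ι y, mem_range_self y, rfl⟩
  obtain ⟨⟨y', hy'⟩, hβy'⟩ := hex.choose_spec
  have hyy' : y' = y := hβ ((congrArg β hy').trans hβy')
  rw [Function.comp_apply, Function.comp_apply, inducedMap, dif_pos hex, ← hy', hyy',
    Function.comp_apply]

variable {E : Type*} [NormedAddCommGroup E] [NormedSpace ℝ E]
  {M : Type*} [TopologicalSpace M] [ChartedSpace E M]
  {F : Type*} [NormedAddCommGroup F] [NormedSpace ℝ F]
  {S : Type*} [TopologicalSpace S] [ChartedSpace F S]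
  {α β : S → M} {ι : M → S}

theorem restrictsToDiffeo_range (hι : ContMDiff 𝓘(ℝ, E) 𝓘(ℝ, F) ∞ ι)
    (he : ∃ e : M ≃ₘ⟮𝓘(ℝ, E), 𝓘(ℝ, E)⟯ M, ⇑e = α ∘ ι) :
    RestrictsToDiffeo F E α (range ι) := by
  obtain ⟨e, he⟩ := he
  have hα (y : M) : α (ι y) = e y := (congrFun he y).symm
  refine ⟨⟨fun _ _ => mem_univ _, ?_, fun x _ => ⟨ι (e.symm x), mem_range_self _, ?_⟩⟩,
    ι ∘ e.symm, hι.comp e.symm.contMDiff, fun x => mem_range_self _, fun x => ?_⟩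
  · rintro _ ⟨y, rfl⟩ _ ⟨y', rfl⟩ hyy'
    rw [hα, hα] at hyy'
    rw [e.injective hyy']
  · rw [hα, e.apply_symm_apply]
  · rw [Function.comp_apply, hα, e.apply_symm_apply]

end InducedMaps

section RealizationsOfScaledTensors

variable {E : Type*} [NormedAddCommGroup E] [NormedSpace ℝ E]
  {M : Type*} [TopologicalSpace M] [ChartedSpace E M] {P : TwoTensorField E M}

theorem IsCasimir.smul {C : M → ℝ} (hC : IsCasimir P C) (c : ℝ) : IsCasimir (c • P) C where
  smooth := hC.smooth
  bracket_eq_zero g hg x := (congrArg (c * ·) (hC.bracket_eq_zero g hg x)).trans (mul_zero c)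

theorem isCasimir_zero_smul {C : M → ℝ} (hC : IsSmoothFun E C) : IsCasimir ((0 : ℝ) • P) C where
  smooth := hC
  bracket_eq_zero _ _ _ := zero_mul _

theorem isInvertible_modelDeriv_diffeomorph (e : M ≃ₘ⟮𝓘(ℝ, E), 𝓘(ℝ, E)⟯ M) (y : M) :
    (modelDeriv E E e y).IsInvertible :=
  ⟨e.mfderivToContinuousLinearEquiv (by simp) y, e.mfderivToContinuousLinearEquiv_coe (by simp)⟩

variable {F : Type*} [NormedAddCommGroup F] [NormedSpace ℝ F] [FiniteDimensional ℝ F]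
  {S : Type*} [TopologicalSpace S] [ChartedSpace F S] [IsManifold 𝓘(ℝ, F) ∞ S]
  {Ω : SymplecticForm F S} {α β : S → M} {σ ι : M → S} {f g : M → ℝ}

theorem bracket_pullbackTensor_eq_of_lagrangian (hR : IsRealizationData Ω P α β σ)
    (hι : IsLagrangianEmbedding (E := E) Ω ι) (he : ∃ e : M ≃ₘ⟮𝓘(ℝ, E), 𝓘(ℝ, E)⟯ M, ⇑e = α ∘ ι)
    (hf : IsSmoothFun E f) (hg : IsSmoothFun E g) (y : M) :
    bracket (pullbackTensor (α ∘ ι) P) (f ∘ β ∘ ι) (g ∘ β ∘ ι) y = bracket P f g (β (ι y)) := by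
  obtain ⟨e, he⟩ := he
  have hιs := hι.embedding.contMDiff
  have hDe : (modelDeriv E E (α ∘ ι) y).IsInvertible :=
    he ▸ isInvertible_modelDeriv_diffeomorph e y
  have hinj : Function.Injective (modelDeriv E F ι y) := by
    have hDαι := hDe.injective
    rw [modelDeriv_comp (hR.mdifferentiable_left _) (hιs.mdifferentiableAt (by simp)),
      ContinuousLinearMap.coe_comp] at hDαι
    exact hDαι.of_comp
  have hsmooth {u : M → ℝ} (hu : IsSmoothFun E u) : IsSmoothFun E (u ∘ β ∘ ι ∘ e.symm) :=
    hu.comp (hR.antiPoisson.smooth.comp (hιs.comp e.symm.contMDiff))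
  have hcomp (u : M → ℝ) : (u ∘ β ∘ ι ∘ e.symm) ∘ α ∘ ι = u ∘ β ∘ ι := by
    rw [← he]
    exact funext fun x => congrArg (u ∘ β ∘ ι) (e.symm_apply_apply x)
  rw [← hcomp f, ← hcomp g, bracket_pullbackTensor_comp_self (he ▸ e.mdifferentiable (by simp) y)
    hDe ((hsmooth hf).mdifferentiableAt (by simp)) ((hsmooth hg).mdifferentiableAt (by simp))]
  exact bracket_eq_of_lagrangian hR hι hinj (hsmooth hf) hf (hcomp f) (hsmooth hg) hg (hcomp g)

theorem bracket_pullbackTensor_eq_of_lagrangian_smul [FiniteDimensional ℝ E]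
    [IsManifold 𝓘(ℝ, E) ∞ M] [T2Space M] {ε : ℝ} (hR : IsRealizationData Ω (ε • P) α β σ)
    (hι : IsLagrangianEmbedding (E := E) Ω ι) (he : ∃ e : M ≃ₘ⟮𝓘(ℝ, E), 𝓘(ℝ, E)⟯ M, ⇑e = α ∘ ι)
    (hcas : ∀ C, IsCasimir (ε • P) C → C ∘ α ∘ ι = C ∘ β ∘ ι)
    (hf : IsSmoothFun E f) (hg : IsSmoothFun E g) (y : M) :
    bracket (pullbackTensor (α ∘ ι) P) (f ∘ β ∘ ι) (g ∘ β ∘ ι) y = bracket P f g (β (ι y)) := by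
  rcases eq_or_ne ε 0 with rfl | hε
  · obtain ⟨e, he⟩ := he
    have hαβ : α ∘ ι = β ∘ ι := funext fun x => eq_of_forall_isSmoothFun_eq (E := E) fun C hC =>
      congrFun (hcas C (isCasimir_zero_smul hC)) x
    rw [← hαβ, ← Function.comp_apply (f := β), ← hαβ]
    exact bracket_pullbackTensor_comp_self (he ▸ e.mdifferentiable (by simp) y)
      (he ▸ isInvertible_modelDeriv_diffeomorph e y) (hf.mdifferentiableAt (by simp))
      (hg.mdifferentiableAt (by simp))
  · exact mul_left_cancel₀ hε (bracket_pullbackTensor_eq_of_lagrangian hR hι he hf hg y)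

theorem eventually_whitneyNhds_casimir_eq [FiniteDimensional ℝ E] [IsManifold 𝓘(ℝ, E) ∞ M]
    [T2Space M] {I J : Set ℝ} {P : ℝ → TwoTensorField E M} {α β : ℝ → S → M}
    (hβ : IsSmoothFamily F E I β) (hJ : IsCompact J) (hJI : J ⊆ I)
    (hσ : MDifferentiable 𝓘(ℝ, E) 𝓘(ℝ, F) σ)
    (hR : ∀ ε ∈ J, IsRealizationData Ω (P ε) (α ε) (β ε) σ) :
    ∀ᶠ ι in whitneyNhds E F σ, ∀ ε ∈ J, ∀ C, IsCasimir (P ε) C → C ∘ α ε ∘ ι = C ∘ β ε ∘ ι := by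
  filter_upwards [hβ.eventually_whitneyNhds_eq_section hJ hJI hσ
    fun ε hε => (hR ε hε).section_right] with ι hι ε hε C hC
  ext y
  have hCα : MDifferentiable 𝓘(ℝ, F) 𝓘(ℝ, ℝ) (C ∘ α ε) :=
    (hC.smooth.mdifferentiable (by simp)).comp (hR ε hε).mdifferentiable_left
  calc C (α ε (ι y)) = C (α ε (σ (β ε (ι y)))) := hι ε hε y (C ∘ α ε) hCα
        fun z v => (hR ε hε).modelDeriv_comp_eq_zero_of_isCasimir hC
    _ = C (β ε (ι y)) := by rw [(hR ε hε).section_left]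

end RealizationsOfScaledTensors

section InducedMapEstimates

variable {E : Type*} [NormedAddCommGroup E] [NormedSpace ℝ E]
  {M : Type*} [TopologicalSpace M] [ChartedSpace E M]
  {P : TwoTensorField E M} {I J : Set ℝ} {n : ℕ} {a a' b b' φ : ℝ → M → M}

namespace IsProperDiffeoFamily

theorem bijective (hb : IsProperDiffeoFamily E J b) {ε : ℝ} (hε : ε ∈ J) :
    Function.Bijective (b ε) := by
  obtain ⟨e, he⟩ := hb.exists_diffeomorph ε hε
  exact he ▸ e.bijective

theorem isInvertible_modelDeriv (hb : IsProperDiffeoFamily E J b) {ε : ℝ} (hε : ε ∈ J) (y : M) :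
    (modelDeriv E E (b ε) y).IsInvertible := by
  obtain ⟨e, he⟩ := hb.exists_diffeomorph ε hε
  exact he ▸ isInvertible_modelDeriv_diffeomorph e y

theorem isUniformO (hb : IsProperDiffeoFamily E J b) (hJ0 : J ∈ 𝓝[I] 0)
    {k : ℕ} {r : ℝ → M → ℝ}
    (hr : ∀ y₀, (fun p => r p.2 (b p.2 p.1)) =O[𝓝 y₀ ×ˢ 𝓝[I] 0] fun p => p.2 ^ k) :
    IsUniformO I k r :=
  isUniformO_of_isBigO_comp hJ0 (fun _ hε => (hb.bijective hε).2) hb.exists_isCompact hr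

end IsProperDiffeoFamily

variable [FiniteDimensional ℝ E]

theorem isUniformO_comp_sub_of_comp_eq (hJ0 : J ∈ 𝓝[I] 0) (haa' : IsApproximation E I n a a')
    (hbb' : IsApproximation E I n b b') (hb'J : IsProperDiffeoFamily E J b')
    (hφ : ∀ ε ∈ J, φ ε ∘ b' ε = a' ε) {C : M → ℝ} (hC : IsSmoothFun E C)
    (hab : ∀ ε ∈ J, C ∘ a ε = C ∘ b ε) :
    IsUniformO I (n + 1) fun ε x => C (φ ε x) - C x := by
  have : LocallyCompactSpace M := ChartedSpace.locallyCompactSpace E M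
  refine hb'J.isUniformO hJ0 fun y₀ =>
    (((hbb' C hC).isBigO y₀).sub ((haa' C hC).isBigO y₀)).congr' ?_ .rfl
  filter_upwards [tendsto_snd hJ0] with p hp
  have hCab : C (a p.2 p.1) = C (b p.2 p.1) := congrFun (hab p.2 hp) p.1
  have hφb' : φ p.2 (b' p.2 p.1) = a' p.2 p.1 := congrFun (hφ p.2 hp) p.1
  rw [hφb', hCab]
  ring

theorem isUniformO_bracket_pullbackTensor_sub [IsManifold 𝓘(ℝ, E) ∞ M] [T2Space M]
    (hP : IsSmoothTensor P) (hI : Convex ℝ I) (hI' : I.Nontrivial) (h0 : (0 : ℝ) ∈ I)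
    (hJI : J ⊆ I) (hJ0 : J ∈ 𝓝[I] 0)
    (ha : IsSmoothFamily E E I a) (ha' : IsSmoothFamily E E I a')
    (haa' : IsApproximation E I n a a') (hb : IsSmoothFamily E E I b)
    (hb' : IsSmoothFamily E E I b') (hbb' : IsApproximation E I n b b')
    (haJ : ∀ y, (modelDeriv E E (a 0) y).IsInvertible) (hb'J : IsProperDiffeoFamily E J b')
    (hφ : ∀ ε ∈ J, φ ε ∘ b' ε = a' ε) {f g : M → ℝ} (hf : IsSmoothFun E f) (hg : IsSmoothFun E g)
    (hab : ∀ ε ∈ J, ∀ y, bracket (pullbackTensor (a ε) P) (f ∘ b ε) (g ∘ b ε) y =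
      bracket P f g (b ε y)) :
    IsUniformO I (n + 1) fun ε x => bracket (pullbackTensor (φ ε) P) f g x - bracket P f g x := by
  have : LocallyCompactSpace M := ChartedSpace.locallyCompactSpace E M
  have hφb' (ε : ℝ) (hε : ε ∈ J) (y : M) : bracket (pullbackTensor (φ ε) P) f g (b' ε y) =
      bracket (pullbackTensor (a' ε) P) (f ∘ b' ε) (g ∘ b' ε) y := by
    obtain ⟨e, he⟩ := hb'J.exists_diffeomorph ε hε
    have hφs : ContMDiff 𝓘(ℝ, E) 𝓘(ℝ, E) ∞ (φ ε) := by
      rw [← e.contMDiff_comp_diffeomorph_iff le_rfl, he, hφ ε hε]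
      exact ha'.contMDiff (hJI hε)
    rw [← hφ ε hε, bracket_pullbackTensor_comp (hφs.mdifferentiableAt (by simp))
      (hb'.mdifferentiableAt (hJI hε) y) (hb'J.isInvertible_modelDeriv hε y)
      (hf.mdifferentiableAt (by simp)) (hg.mdifferentiableAt (by simp))]
  refine hb'J.isUniformO hJ0 fun y₀ => (((hbb' _ (hP f g hf hg)).isBigO y₀).sub
    (isBigO_bracket_pullbackTensor_sub hP hI hI' h0 ha ha' haa' hb hb' hbb' hf hg
      (haJ y₀))).congr' ?_ .rfl
  filter_upwards [tendsto_snd hJ0] with p hp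
  rw [hφb' p.2 hp, hab p.2 hp]
  ring

end InducedMapEstimates

end PoissonRealization

open PoissonRealization in
theorem theorem1_general
    {E : Type*} [NormedAddCommGroup E] [NormedSpace ℝ E] [FiniteDimensional ℝ E]
    {M : Type*} [TopologicalSpace M] [ChartedSpace E M] [IsManifold 𝓘(ℝ, E) ∞ M]
    [T2Space M] [SigmaCompactSpace M]
    {F : Type*} [NormedAddCommGroup F] [NormedSpace ℝ F] [FiniteDimensional ℝ F]
    {S : Type*} [TopologicalSpace S] [ChartedSpace F S] [IsManifold 𝓘(ℝ, F) ∞ S]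
    {P : TwoTensorField E M} (hP : IsSmoothTensor P) {Ω : SymplecticForm F S}
    {I : Set ℝ} (hI : I.OrdConnected) (hI' : I.Nontrivial) (h0 : (0 : ℝ) ∈ I)
    {n : ℕ} {αhat βhat : ℝ → S → M} {σ : M → S}
    (hR : IsApproxRealizationData Ω P I n αhat βhat σ)
    {J : Set ℝ} (hJ : IsCompact J) (hJI : J ⊆ I) (hJ0 : J ∈ 𝓝[I] 0) :
    ∃ W : Set (OneJets E M F S), IsOpen W ∧ JetsIn W σ ∧
      ∀ ι : M → S, JetsIn W ι → ContMDiff 𝓘(ℝ, E) 𝓘(ℝ, F) ∞ ι →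
        (∀ ε ∈ J, IsBisection F E (αhat ε) (βhat ε) (range ι)) ∧
        (IsLagrangianEmbedding (E := E) Ω ι →
          ∀ f g : M → ℝ, IsSmoothFun E f → IsSmoothFun E g →
            IsUniformO I (n + 1) (fun ε x =>
              bracket (pullbackTensor (inducedMap (αhat ε) (βhat ε) (range ι)) P) f g x
                - bracket P f g x)) ∧
        (∀ C : M → ℝ, IsCasimir P C →
          IsUniformO I (n + 1) (fun ε x =>
            C (inducedMap (αhat ε) (βhat ε) (range ι) x) - C x)) := by
  obtain ⟨α, β, hα, hβ, hdata, hαα, hββ⟩ := hR.approximates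
  have hσ : MDifferentiable 𝓘(ℝ, E) 𝓘(ℝ, F) σ :=
    (hdata 0 h0).lagrangian.embedding.contMDiff.mdifferentiable (by simp)
  refine eventually_whitneyNhds.1 ?_
  filter_upwards [
    hR.smooth_left.eventually_isProperDiffeoFamily hJ hJI hσ fun ε hε => hR.section_left ε (hJI hε),
    hR.smooth_right.eventually_isProperDiffeoFamily hJ hJI hσ
      fun ε hε => hR.section_right ε (hJI hε),
    hα.eventually_isProperDiffeoFamily hJ hJI hσ fun ε hε => (hdata ε (hJI hε)).section_left,
    eventually_whitneyNhds_casimir_eq hβ hJ hJI hσ fun ε hε => hdata ε (hJI hε)]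
    with ι hαhat hβhat hαι hcas hι
  specialize hαhat hι
  specialize hβhat hι
  specialize hαι hι
  have hφ (ε : ℝ) (hε : ε ∈ J) := inducedMap_range_comp (α := αhat ε) (hβhat.bijective hε).1
  have hαα := hαα.comp_continuous hι.continuous
  have hββ := hββ.comp_continuous hι.continuous
  refine ⟨fun ε hε => ⟨restrictsToDiffeo_range hι (hαhat.exists_diffeomorph ε hε),
    restrictsToDiffeo_range hι (hβhat.exists_diffeomorph ε hε)⟩, fun hL f g hf hg => ?_,
    fun C hC => isUniformO_comp_sub_of_comp_eq hJ0 hαα hββ hβhat hφ hC.smooth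
      fun ε hε => hcas ε hε C (hC.smul ε)⟩
  exact isUniformO_bracket_pullbackTensor_sub hP hI.convex hI' h0 hJI hJ0 (hα.comp_right hι)
    (hR.smooth_left.comp_right hι) hαα (hβ.comp_right hι) (hR.smooth_right.comp_right hι) hββ
    (hαι.isInvertible_modelDeriv (mem_of_mem_nhdsWithin h0 hJ0)) hβhat hφ hf hg fun ε hε =>
      bracket_pullbackTensor_eq_of_lagrangian_smul (hdata ε (hJI hε)) hL
        (hαι.exists_diffeomorph ε hε) (hcas ε hε) hf hg

open PoissonRealization in
theorem theorem1
    {E : Type*} [NormedAddCommGroup E] [NormedSpace ℝ E] [FiniteDimensional ℝ E]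
    {M : Type*} [TopologicalSpace M] [ChartedSpace E M] [IsManifold 𝓘(ℝ, E) ∞ M]
    [T2Space M] [SecondCountableTopology M]
    {F : Type*} [NormedAddCommGroup F] [NormedSpace ℝ F] [FiniteDimensional ℝ F]
    {S : Type*} [TopologicalSpace S] [ChartedSpace F S] [IsManifold 𝓘(ℝ, F) ∞ S]
    [T2Space S] [SecondCountableTopology S]
    (P : TwoTensorField E M) (hP : IsPoissonTensor P)
    (Ω : SymplecticForm F S)
    -- the parameter `ε` ranges over an interval `I` containing `0`, e.g. `[0, ε₁)` or `[0, ∞)`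
    (I : Set ℝ) (hI : I.OrdConnected) (hI' : I.Nontrivial) (h0 : (0 : ℝ) ∈ I)
    (n : ℕ) (αhat βhat : ℝ → S → M) (σ : M → S)
    (hR : IsApproxRealizationData Ω P I n αhat βhat σ)
    -- any compact range `J ⊆ I` of parameters that is a neighbourhood of `0` in `I`
    (J : Set ℝ) (hJ : IsCompact J) (hJI : J ⊆ I) (hJ0 : J ∈ 𝓝[I] 0) :
    ∃ W : Set (OneJets E M F S), IsOpen W ∧ JetsIn W σ ∧
      ∀ ι : M → S, IsLagrangianEmbedding (E := E) Ω ι → JetsIn W ι →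
        (∀ ε ∈ J, IsBisection F E (αhat ε) (βhat ε) (range ι)) ∧
        (∀ f g : M → ℝ, IsSmoothFun E f → IsSmoothFun E g →
          IsUniformO I (n + 1) (fun ε x =>
            bracket (pullbackTensor (inducedMap (αhat ε) (βhat ε) (range ι)) P) f g x
              - bracket P f g x)) ∧
        (∀ C : M → ℝ, IsCasimir P C →
          IsUniformO I (n + 1) (fun ε x =>
            C (inducedMap (αhat ε) (βhat ε) (range ι) x) - C x)) := by
  have := ChartedSpace.locallyCompactSpace E M
  obtain ⟨W, hWo, hσW, hW⟩ := theorem1_general hP.smooth hI hI' h0 hR hJ hJI hJ0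
  exact ⟨W, hWo, hσW, fun ι hι hιW => (hW ι hιW hι.embedding.contMDiff).imp_right
    fun h => ⟨h.1 hι, h.2⟩⟩
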